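/- **Theorem.** For an undirected unweighted graph $\Gamma$ on a finite vertex set $V$ let $d_\Gamma(u,v)$ be the number of edges of a shortest $u$–$v$ path in $\Gamma$ ($\infty$ if there is none). A graph $G$ on the same vertex set $V$ is regarded as edge-weighted, an edge $uv$ of $G$ having weight $d_\Gamma(u,v)$; $d_G(u,v)$ denotes the weighted shortest-path distance in $G$ ($\infty$ if there is no path). The dilation of $G$ is at most $t$ if $d_G(u,v)\le t\cdot d_\Gamma(u,v)$ for all $u,v\in V$. *Dilation 2-Augmentation* asks, given $(G,\Gamma,k)$ with $k\in\mathbb N$, whether there is a set $S$ of at most $k$ non-edges of $G$ such that the graph $G+S=(V,E(G)\cup S)$, again weighted by distances in $\Gamma$, has dilation at most $2$. There are an algorithm, a computable function $f:\mathbb N^2\to\mathbb N$ and a constant $c$ such that, for every $d,k\in\mathbb N$, every graph $G$ on $n$ vertices that does not contain the complete bipartite graph $K_{d,d}$ as a subgraph, and every graph $\Gamma$ on $V(G)$, the algorithm on input $(G,\Gamma,k,d)$ halts after at most $f(k,d)\cdot (n+1)^{c}$ steps and decides correctly whether $(G,\Gamma,k)$ is a yes-instance of Dilation 2-Augmentation.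 Here algorithms are programs of a unit-cost random access machine on natural numbers with addition and truncated subtraction; graphs are given by adjacency matrices. -/

import Mathlib

/-! ### Dilation of a graph embedded in the shortest-path metric of another graph -/

namespace Dilation

/-- The weight of a walk of `G`, where every edge `uv` of `G` has as its weight the (hop)
distance between `u` and `v` in the unweighted graph `Γ` (`⊤` if there is no `u`-`v` path in `Γ`). -/
noncomputable def walkWeight {V : Type*} (Γ : SimpleGraph V) {G : SimpleGraph V} {u v : V}
    (p : G.Walk u v) : ℕ∞ :=
  (p.darts.map fun e => Γ.edist e.fst e.snd).sum

/-- The weighted shortest-path distance in `G`, edges being weighted by distances in `Γ`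
(`⊤` if there is no walk from `u` to `v`). -/
noncomputable def weightedDist {V : Type*} (Γ G : SimpleGraph V) (u v : V) : ℕ∞ :=
  ⨅ p : G.Walk u v, walkWeight Γ p

/-- `G`, embedded in the shortest-path metric of `Γ`, is a `t`-spanner,
that is, its dilation is at most `t`. -/
def DilationAtMost {V : Type*} (t : ℕ) (Γ G : SimpleGraph V) : Prop :=
  ∀ u v : V, weightedDist Γ G u v ≤ (t : ℕ∞) * Γ.edist u v

/-- `(G, Γ, k)` is a yes-instance of Dilation `t`-Augmentation: one can add at most `k` new edges
to `G` so that the dilation becomes at most `t`. -/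
def IsYesInstance {V : Type*} (t : ℕ) (G Γ : SimpleGraph V) (k : ℕ) : Prop :=
  ∃ S : Finset (Sym2 V), (S : Set (Sym2 V)) ⊆ Gᶜ.edgeSet ∧ S.card ≤ k ∧
    DilationAtMost t Γ (G ⊔ SimpleGraph.fromEdgeSet (S : Set (Sym2 V)))

/-- `G` does not contain the complete bipartite graph `K_{d,d}` as a (not necessarily induced)
subgraph. -/
def BicliqueFree {V : Type*} (d : ℕ) (G : SimpleGraph V) : Prop :=
  (completeBipartiteGraph (Fin d) (Fin d)).Free G

end Dilation

/-! ### Random access machines with a step count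

Registers and array cells hold natural numbers.  The arithmetic consists of addition and truncated
subtraction only, so that with unit costs the model is equivalent to Turing machines up to a
polynomial in the running time and the input length.  Control flow is structured.  A program
mentions only finitely many registers and arrays, whose names are constants of the program;
a cell of an array is addressed by the content of a register. -/

namespace RAM

/-- A memory state: the contents of the registers and of the arrays. -/
structure State where
  reg : ℕ → ℕ
  arr : ℕ → ℕ → ℕ

/-- `s.setReg x a` is `s` with the content of register `x` replaced by `a`. -/
def State.setReg (s : State) (x a : ℕ) : State :=
  { s with reg := Function.update s.reg x a }

/-- `s.setArr A i a` is `s` with the content of cell `i` of array `A` replaced by `a`. -/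
def State.setArr (s : State) (A i a : ℕ) : State :=
  { s with arr := Function.update s.arr A (Function.update (s.arr A) i a) }

/-- Programs. Here `x y z i` are names of registers and `A` is the name of an array. -/
inductive Program where
  /-- do nothing -/
  | skip : Program
  /-- `x := c` for a constant `c` -/
  | const (x c : ℕ) : Program
  /-- `x := y + z` -/
  | add (x y z : ℕ) : Program
  /-- `x := max (y - z) 0` -/
  | sub (x y z : ℕ) : Program
  /-- `x := A[i]` -/
  | load (x A i : ℕ) : Program
  /-- `A[i] := x` -/
  | store (A i x : ℕ) : Program
  /-- `P; Q` -/
  | seq (P Q : Program) : Program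
  /-- `if x ≠ 0 then P else Q` -/
  | ite (x : ℕ) (P Q : Program) : Program
  /-- `while x ≠ 0 do P` -/
  | loop (x : ℕ) (P : Program) : Program

/-- `Exec P s s' T`: program `P`, started in state `s`, halts in state `s'` after exactly `T` steps.
Every elementary instruction and every test is one step. -/
inductive Exec : Program → State → State → ℕ → Prop
  | skip (s : State) : Exec .skip s s 1
  | const (s : State) (x c : ℕ) : Exec (.const x c) s (s.setReg x c) 1
  | add (s : State) (x y z : ℕ) : Exec (.add x y z) s (s.setReg x (s.reg y + s.reg z)) 1
  | sub (s : State) (x y z : ℕ) : Exec (.sub x y z) s (s.setReg x (s.reg y - s.reg z)) 1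
  | load (s : State) (x A i : ℕ) : Exec (.load x A i) s (s.setReg x (s.arr A (s.reg i))) 1
  | store (s : State) (A i x : ℕ) : Exec (.store A i x) s (s.setArr A (s.reg i) (s.reg x)) 1
  | seq {P Q : Program} {s s' s'' : State} {T T' : ℕ} :
      Exec P s s' T → Exec Q s' s'' T' → Exec (.seq P Q) s s'' (T + T')
  | ite_true {x : ℕ} {P Q : Program} {s s' : State} {T : ℕ} :
      s.reg x ≠ 0 → Exec P s s' T → Exec (.ite x P Q) s s' (T + 1)
  | ite_false {x : ℕ} {P Q : Program} {s s' : State} {T : ℕ} :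
      s.reg x = 0 → Exec Q s s' T → Exec (.ite x P Q) s s' (T + 1)
  | loop_done {x : ℕ} {P : Program} {s : State} :
      s.reg x = 0 → Exec (.loop x P) s s 1
  | loop_step {x : ℕ} {P : Program} {s s' s'' : State} {T T' : ℕ} :
      s.reg x ≠ 0 → Exec P s s' T → Exec (.loop x P) s' s'' T' →
        Exec (.loop x P) s s'' (T + T' + 1)

end RAM

namespace Dilation

open Classical in
/-- The adjacency matrix of a graph on `{0, …, n-1}` as an array, row by row:
the entry for `(u, v)` is stored in cell `u * n + v`. -/
noncomputable def adjArray {n : ℕ} (G : SimpleGraph (Fin n)) (p : ℕ) : ℕ :=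
  if ∃ u v : Fin n, G.Adj u v ∧ p = (u : ℕ) * n + (v : ℕ) then 1 else 0

/-- The initial state on the input `(G, Γ, k, d)`: registers `0, 1, 2` hold `n, k, d`, arrays `0, 1`
hold the adjacency matrices of `G` and `Γ`, and everything else is `0`. -/
noncomputable def inputState {n : ℕ} (G Γ : SimpleGraph (Fin n)) (k d : ℕ) : RAM.State where
  reg := fun x => if x = 0 then n else if x = 1 then k else if x = 2 then d else 0
  arr := fun A => if A = 0 then adjArray G else if A = 1 then adjArray Γ else fun _ => 0

open Classical in
/-- The final state `s` carries the answer to the yes/no question `Q` in register `0`. -/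
def Answers (s : RAM.State) (Q : Prop) : Prop :=
  s.reg 0 = if Q then 1 else 0

end Dilation

/-!
Distances in `Γ` can be checked edge by edge, so the dilation of `G` is at most two if and only if
every edge `uv` of `Γ` lies in `E = G ⊓ Γ` or is bridged by a path `u w v` in `E`
(`dilationAtMost_two_iff`). An edge of `Γ` for which this fails is a *conflict*, and the task is to
remove all conflicts by adding at most `k` edges of `Γ` to `E` (`isYesInstance_two_iff`). The
algorithm guesses the new edges one after the other; the point is that at each moment some edge of
a solution joins two vertices from short lists of candidates (`Resolves.exists_candidate`).

If some vertex `u` has very many conflicts `uv`, then a new edge at `v` can account for at most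
`2k` of them. For all others the solution has an edge `uw` such that `wv` is an edge of `G`, so one
of these at most `k` vertices `w` has many neighbours among the conflicts of `u`
(`Resolves.exists_mem_of_card_conflicts`). As `G` has no `K_{d,d}`, the number of such `w` is bounded
(`BicliqueFree.card_le_of_forall_card_le`).

If no vertex has so many conflicts, then, since every conflict has an end in common with a new edge,
the set `Z` of vertices with a conflict has bounded size (`Resolves.card_conflictVerts_le`). Vertices
outside `Z` with the same neighbours in `Z` are interchangeable, even for all new edges at once, so
only the first vertex of each of the at most `4 ^ |Z|` types is needed
(`Resolves.exists_rearranged`).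

The numbers of the chosen candidates are the digits, in base `paramB k d`, of a number below
`paramF k d`, and all these numbers are tried (`isYesInstance_two_iff_exists_search`). The program
is written in a small language whose expressions have bounded sums, which serve as quantifiers and
for counting, and whose loops have a number of rounds read from a register. Its compiler to RAM
programs is verified once and for all (`RAM.Command.code_spec`). When all sums and loops are bounded
by `X`, the running time is polynomial in `X` (`RAM.Command.exists_time_le`), and here
`X = paramF k d * (n + 1)` suffices.
-/


/-! ### Total correctness of programs with a time bound -/

namespace RAM

/-- `P.Achieves s b φ`: started in state `s`, the program `P` halts after at most `b` steps in a
state that satisfies `φ`. -/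
def Program.Achieves (P : Program) (s : State) (b : ℕ) (φ : State → Prop) : Prop :=
  ∃ s' T, Exec P s s' T ∧ T ≤ b ∧ φ s'

namespace Program

variable {P Q : Program} {s : State} {b b' : ℕ} {φ ψ : State → Prop}

theorem Achieves.mono (h : P.Achieves s b φ) (hb : b ≤ b') (hφ : ∀ s', φ s' → ψ s') :
    P.Achieves s b' ψ := by
  obtain ⟨s', T, h1, h2, h3⟩ := h
  exact ⟨s', T, h1, h2.trans hb, hφ _ h3⟩

theorem Achieves.seq (h : P.Achieves s b fun s' => Q.Achieves s' b' φ) :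
    (Program.seq P Q).Achieves s (b + b') φ := by
  obtain ⟨s', T, h1, h2, s'', T', h3, h4, h5⟩ := h
  exact ⟨s'', T + T', .seq h1 h3, by omega, h5⟩

theorem achieves_const {x c : ℕ} (h : φ (s.setReg x c)) : (const x c).Achieves s 1 φ :=
  ⟨_, _, .const .., le_rfl, h⟩

theorem achieves_add {x y z : ℕ} (h : φ (s.setReg x (s.reg y + s.reg z))) :
    (add x y z).Achieves s 1 φ :=
  ⟨_, _, .add .., le_rfl, h⟩

theorem achieves_sub {x y z : ℕ} (h : φ (s.setReg x (s.reg y - s.reg z))) :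
    (sub x y z).Achieves s 1 φ :=
  ⟨_, _, .sub .., le_rfl, h⟩

theorem achieves_load {x A i : ℕ} (h : φ (s.setReg x (s.arr A (s.reg i)))) :
    (load x A i).Achieves s 1 φ :=
  ⟨_, _, .load .., le_rfl, h⟩

theorem achieves_store {A i x : ℕ} (h : φ (s.setArr A (s.reg i) (s.reg x))) :
    (store A i x).Achieves s 1 φ :=
  ⟨_, _, .store .., le_rfl, h⟩

/-- A loop whose control register counts down: `I m` is the invariant with `m` rounds to go. -/
theorem achieves_loop {x : ℕ} (I : ℕ → State → Prop) (hx : ∀ m τ, I m τ → τ.reg x = m)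
    (hI : ∀ m τ, I (m + 1) τ → P.Achieves τ b (I m)) (m : ℕ) (s : State) (h : I m s) :
    (loop x P).Achieves s (m * (b + 1) + 1) (I 0) := by
  induction m generalizing s with
  | zero => exact ⟨s, 1, .loop_done (hx _ _ h), by omega, h⟩
  | succ m ih =>
    obtain ⟨s', T, h1, h2, h3⟩ := hI m s h
    obtain ⟨s'', T', h4, h5, h6⟩ := ih s' h3
    refine ⟨s'', T + T' + 1, .loop_step (by rw [hx _ _ h]; omega) h1 h4, ?_, h6⟩
    rw [Nat.succ_mul]
    omega

end Program

@[simp] theorem State.setReg_reg (s : State) (x a y : ℕ) :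
    (s.setReg x a).reg y = if y = x then a else s.reg y := by
  simp [State.setReg, Function.update_apply]

@[simp] theorem State.setReg_arr (s : State) (x a : ℕ) : (s.setReg x a).arr = s.arr := rfl

@[simp] theorem State.setArr_reg (s : State) (A i a : ℕ) : (s.setArr A i a).reg = s.reg := rfl

theorem State.setArr_arr (s : State) (A i a B j : ℕ) :
    (s.setArr A i a).arr B j = if B = A ∧ j = i then a else s.arr B j := by
  simp only [State.setArr, Function.update_apply]
  split_ifs <;> simp_all

/-- The states `s` and `s'` agree on all arrays and on the registers below `W`. -/
def Agree (W : ℕ) (s s' : State) : Prop :=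
  s.arr = s'.arr ∧ ∀ x < W, s.reg x = s'.reg x

theorem Agree.setReg {W : ℕ} {s s' : State} (h : Agree W s s') (x a : ℕ) :
    Agree W (s.setReg x a) (s'.setReg x a) :=
  ⟨h.1, fun y hy => by simp [h.2 y hy]⟩

/-! ### A language of arithmetic expressions with bounded sums -/

/-- Arithmetic expressions over registers and arrays. -/
inductive Expression where
  /-- the content of register `x` -/
  | var (x : ℕ) : Expression
  /-- the constant `c` -/
  | num (c : ℕ) : Expression
  /-- the sum of two values -/
  | add (a b : Expression) : Expression
  /-- the truncated difference of two values -/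
  | sub (a b : Expression) : Expression
  /-- the content of cell `i` of array `A` -/
  | get (A : ℕ) (i : Expression) : Expression
  /-- the sum of the values of `e`, where `x` runs from `0` to the content of register `r` minus
  one -/
  | sum (x r : ℕ) (e : Expression) : Expression

namespace Expression

/-- The value of an expression. -/
def eval : Expression → State → ℕ
  | var x, σ => σ.reg x
  | num c, _ => c
  | add a b, σ => a.eval σ + b.eval σ
  | sub a b, σ => a.eval σ - b.eval σ
  | get A i, σ => σ.arr A (i.eval σ)
  | sum x r e, σ => ∑ i ∈ Finset.range (σ.reg r), e.eval (σ.setReg x i)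

/-- The program that computes the value of an expression into register `t`, where the registers
from `t` on serve as scratch memory. In the code of a sum, register `t` saves the old content of the
summation variable `x`, which is restored at the end, `t + 1` accumulates the sum, `t + 2` counts the
remaining rounds down, `t + 3` counts the finished rounds up, and `t + 4` holds constants. -/
def code : Expression → ℕ → Program
  | var x, t => .seq (.const t 0) (.add t x t)
  | num c, t => .const t c
  | add a b, t => .seq (a.code t) (.seq (b.code (t + 1)) (.add t t (t + 1)))
  | sub a b, t => .seq (a.code t) (.seq (b.code (t + 1)) (.sub t t (t + 1)))
  | get A i, t => .seq (i.code t) (.load t A t)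
  | sum x r e, t =>
    .seq (.const (t + 1) 0) <| .seq (.add t x (t + 1)) <| .seq (.add (t + 2) r (t + 1)) <|
    .seq (.const (t + 3) 0) <| .seq
      (.loop (t + 2) <|
        .seq (.const (t + 4) 0) <| .seq (.add x (t + 3) (t + 4)) <| .seq (e.code (t + 5)) <|
        .seq (.add (t + 1) (t + 1) (t + 5)) <| .seq (.const (t + 4) 1) <|
        .seq (.add (t + 3) (t + 3) (t + 4)) (.sub (t + 2) (t + 2) (t + 4))) <|
    .seq (.const (t + 4) 0) <| .seq (.add x t (t + 4)) (.add t (t + 1) (t + 4))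

/-- A bound on the running time of `code` when every sum has at most `X` summands. -/
def time : Expression → ℕ → ℕ
  | var _, _ => 2
  | num _, _ => 1
  | add a b, X => a.time X + (b.time X + 1)
  | sub a b, X => a.time X + (b.time X + 1)
  | get _ i, X => i.time X + 1
  | sum _ _ e, X => X * (e.time X + 7) + 8

/-- All registers of the expression are below `W`, all sums are bounded by registers in `R`, and no
register in `R` is a summation variable. This ensures that the code, compiled with scratch memory
from `W` on, is correct, and that its time depends on the contents of the registers in `R` only. -/
def ok (W : ℕ) (R : List ℕ) : Expression → Bool
  | var x => x.blt W
  | num _ => true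
  | add a b => a.ok W R && b.ok W R
  | sub a b => a.ok W R && b.ok W R
  | get _ i => i.ok W R
  | sum x r e => x.blt W && !R.contains x && R.contains r && r.blt W && e.ok W R

theorem eval_congr {W : ℕ} {R : List ℕ} {s s' : State} (h : Agree W s s') (e : Expression)
    (he : e.ok W R = true) : e.eval s = e.eval s' := by
  induction e generalizing s s' with
  | var x => exact h.2 x (by simpa [ok] using he)
  | num c => rfl
  | add a b iha ihb | sub a b iha ihb =>
    simp only [ok, Bool.and_eq_true] at he
    simp only [eval, iha h he.1, ihb h he.2]
  | get A i ih =>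
    simp only [ok] at he
    simp only [eval, ih h he, h.1]
  | sum x r e ih =>
    simp only [ok, Bool.and_eq_true, Nat.blt_eq] at he
    simp only [eval, h.2 r he.1.2]
    exact Finset.sum_congr rfl fun i _ => ih (h.setReg x i) he.2

/-- The code of an expression computes its value within the time bound, and it changes neither the
arrays nor the registers outside its scratch memory. -/
theorem code_spec {W X : ℕ} {R : List ℕ} (e : Expression) {s : State} {t : ℕ}
    (he : e.ok W R = true) (ht : W ≤ t) (hX : ∀ r < W, r ∈ R → s.reg r ≤ X) :
    (e.code t).Achieves s (e.time X) fun s' =>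
      s'.arr = s.arr ∧ (∀ x < t, s'.reg x = s.reg x) ∧ s'.reg t = e.eval s := by
  induction e generalizing s t with
  | var x =>
    have hx : x < W := by simpa [ok] using he
    refine Program.Achieves.seq (b := 1) (b' := 1) (Program.achieves_const
      (Program.achieves_add ⟨rfl, fun y hy => ?_, ?_⟩))
    · simp [hy.ne]
    · simp [eval, (hx.trans_le ht).ne]
  | num c => exact Program.achieves_const ⟨rfl, fun y hy => by simp [hy.ne], by simp [eval]⟩
  | add a b iha ihb | sub a b iha ihb =>
    simp only [ok, Bool.and_eq_true] at he
    refine Program.Achieves.seq ((iha he.1 ht hX).mono le_rfl fun s' hs => ?_)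
    obtain ⟨h1, h2, h3⟩ := hs
    have hag : Agree W s' s := ⟨h1, fun y hy => h2 y (by omega)⟩
    refine Program.Achieves.seq ((ihb he.2 (t := t + 1) (by omega)
      (fun r hr hR => (hag.2 r hr).trans_le (hX r hr hR))).mono le_rfl fun s'' hs => ?_)
    obtain ⟨h4, h5, h6⟩ := hs
    first
    | refine Program.achieves_add ⟨h4.trans h1, fun y hy => ?_, ?_⟩
    | refine Program.achieves_sub ⟨h4.trans h1, fun y hy => ?_, ?_⟩
    · simp [hy.ne, h5 y (by omega), h2 y hy]
    · simp [eval, h6, h5 t (by omega), h3, eval_congr hag b he.2]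
  | get A i ih =>
    simp only [ok] at he
    refine Program.Achieves.seq ((ih he ht hX).mono le_rfl fun s' hs => ?_)
    obtain ⟨h1, h2, h3⟩ := hs
    refine Program.achieves_load ⟨h1, fun y hy => ?_, ?_⟩
    · simp [hy.ne, h2 y hy]
    · simp [eval, h3, h1]
  | sum x r e ih =>
    simp only [ok, Bool.and_eq_true, Nat.blt_eq, Bool.not_eq_true', List.contains_iff_mem,
      Bool.eq_false_iff, ne_eq] at he
    obtain ⟨⟨⟨⟨hxW, hxR⟩, hrR⟩, hrW⟩, he⟩ := he
    have hr := hX r hrW hrR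
    set m₀ := s.reg r with hm₀
    -- with `m` rounds to go, the counter holds `m₀ - m` and the accumulator the sum so far
    let I : ℕ → State → Prop := fun m τ => τ.arr = s.arr ∧ (∀ y < t, y ≠ x → τ.reg y = s.reg y) ∧
      τ.reg t = s.reg x ∧ m ≤ m₀ ∧ τ.reg (t + 2) = m ∧ τ.reg (t + 3) = m₀ - m ∧
      τ.reg (t + 1) = ∑ i ∈ Finset.range (m₀ - m), e.eval (s.setReg x i)
    have key : (Program.loop (t + 2) <|
        .seq (.const (t + 4) 0) <| .seq (.add x (t + 3) (t + 4)) <| .seq (e.code (t + 5)) <|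
        .seq (.add (t + 1) (t + 1) (t + 5)) <| .seq (.const (t + 4) 1) <|
        .seq (.add (t + 3) (t + 3) (t + 4)) (.sub (t + 2) (t + 2) (t + 4))).Achieves
        ((((s.setReg (t + 1) 0).setReg t (s.reg x)).setReg (t + 2) m₀).setReg (t + 3) 0)
        (m₀ * (e.time X + 6 + 1) + 1) (I 0) := by
      refine Program.achieves_loop I (fun m τ h => h.2.2.2.2.1) ?_ m₀ _ ?_
      · rintro m τ ⟨h1, h2, h3, h4, h5, h6, h7⟩
        refine Program.Achieves.mono (b := 1 + (1 + (e.time X + (1 + (1 + (1 + 1))))))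
          ?_ (by omega) fun _ h => h
        refine Program.Achieves.seq (Program.achieves_const ?_)
        refine Program.Achieves.seq (Program.achieves_add ?_)
        have hag : Agree W (((τ.setReg (t + 4) 0).setReg x
            ((τ.setReg (t + 4) 0).reg (t + 3) + (τ.setReg (t + 4) 0).reg (t + 4))))
            (s.setReg x (m₀ - (m + 1))) := by
          refine ⟨h1, fun y hy => ?_⟩
          have : y ≠ t + 4 := by omega
          by_cases hyx : y = x
          · simp [hyx, h6]
          · simp [hyx, this, h2 y (by omega) hyx]
        refine Program.Achieves.seq ((ih he (t := t + 5) (by omega) ?_).mono le_rfl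
          fun s' hs => ?_)
        · intro r' hr' hR'
          have : r' ≠ x := fun h => hxR (h ▸ hR')
          rw [hag.2 r' hr']
          simpa [this] using hX r' hr' hR'
        obtain ⟨h8, h9, h10⟩ := hs
        rw [eval_congr hag e he] at h10
        refine Program.Achieves.seq (Program.achieves_add ?_)
        refine Program.Achieves.seq (Program.achieves_const ?_)
        refine Program.Achieves.seq (Program.achieves_add ?_)
        refine Program.achieves_sub ?_
        have e1 : m₀ - m = (m₀ - (m + 1)) + 1 := by omega
        have n1 : t + 1 ≠ x := by omega
        have n2 : t + 2 ≠ x := by omega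
        have n3 : t + 3 ≠ x := by omega
        refine ⟨h8.trans h1, fun y hy hyx => ?_, ?_, by omega, ?_, ?_, ?_⟩
        · have a1 : y ≠ t + 1 := by omega
          have a2 : y ≠ t + 2 := by omega
          have a3 : y ≠ t + 3 := by omega
          have a4 : y ≠ t + 4 := by omega
          simp [a1, a2, a3, a4, h9 y (by omega), hyx, h2 y hy hyx]
        · have : t ≠ x := by omega
          simp [h9 t (by omega), this, h3]
        · simp [h9 (t + 2) (by omega), n2, h5]
        · simp [h9 (t + 3) (by omega), n3, h6]
          omega
        · simp [h9 (t + 1) (by omega), n1, h7, h10, e1, Finset.sum_range_succ]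
      · refine ⟨rfl, fun y hy hyx => ?_, ?_, le_rfl, ?_, ?_, ?_⟩
        · have a1 : y ≠ t + 1 := by omega
          have a2 : y ≠ t + 2 := by omega
          have a3 : y ≠ t + 3 := by omega
          simp [a1, a2, a3, hy.ne]
        all_goals simp
    refine Program.Achieves.mono
      (b := 1 + (1 + (1 + (1 + (m₀ * (e.time X + 6 + 1) + 1 + (1 + (1 + 1)))))))
      ?_ ?_ fun _ h => h
    · refine Program.Achieves.seq (Program.achieves_const ?_)
      refine Program.Achieves.seq (Program.achieves_add ?_)
      refine Program.Achieves.seq (Program.achieves_add ?_)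
      refine Program.Achieves.seq (Program.achieves_const ?_)
      refine Program.Achieves.seq ?_
      have q1 : (s.setReg (t + 1) 0).reg x + (s.setReg (t + 1) 0).reg (t + 1) = s.reg x := by
        have : x ≠ t + 1 := by omega
        simp [this]
      rw [q1]
      have q2 : ((s.setReg (t + 1) 0).setReg t (s.reg x)).reg r +
          ((s.setReg (t + 1) 0).setReg t (s.reg x)).reg (t + 1) = m₀ := by
        have a1 : r ≠ t + 1 := by omega
        have a2 : r ≠ t := by omega
        simp [a1, a2, hm₀]
      rw [q2]
      refine key.mono le_rfl ?_
      rintro τ ⟨h1, h2, h3, -, -, -, h7⟩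
      refine Program.Achieves.seq (Program.achieves_const ?_)
      refine Program.Achieves.seq (Program.achieves_add ?_)
      refine Program.achieves_add ?_
      refine ⟨h1, fun y hy => ?_, ?_⟩
      · have a4 : y ≠ t + 4 := by omega
        by_cases hyx : y = x
        · subst hyx
          simp [hy.ne, h3]
        · simp [hy.ne, hyx, a4, h2 y hy hyx]
      · have : t + 1 ≠ x := by omega
        have : t + 4 ≠ x := by omega
        simp [*, eval]
    · have : m₀ * (e.time X + 6 + 1) ≤ X * (e.time X + 7) := Nat.mul_le_mul_right _ hr
      simp only [time]
      omega

theorem exists_time_le (e : Expression) : ∃ K D : ℕ, ∀ X, 1 ≤ X → e.time X ≤ K * X ^ D := by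
  induction e with
  | var x => exact ⟨2, 0, fun X _ => by simp [time]⟩
  | num c => exact ⟨1, 0, fun X _ => by simp [time]⟩
  | add a b iha ihb | sub a b iha ihb =>
    obtain ⟨K, D, h⟩ := iha
    obtain ⟨K', D', h'⟩ := ihb
    refine ⟨K + K' + 1, D + D', fun X hX => ?_⟩
    have h1 := h X hX
    have h2 := h' X hX
    have h3 : X ^ D ≤ X ^ (D + D') := Nat.pow_le_pow_right hX (by omega)
    have h4 : X ^ D' ≤ X ^ (D + D') := Nat.pow_le_pow_right hX (by omega)
    have h5 : 1 ≤ X ^ (D + D') := Nat.one_le_pow _ _ hX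
    simp only [time]
    nlinarith [Nat.mul_le_mul_left K h3, Nat.mul_le_mul_left K' h4]
  | get A i ih =>
    obtain ⟨K, D, h⟩ := ih
    refine ⟨K + 1, D, fun X hX => ?_⟩
    have h1 := h X hX
    have h5 : 1 ≤ X ^ D := Nat.one_le_pow _ _ hX
    simp only [time]
    nlinarith
  | sum x r e ih =>
    obtain ⟨K, D, h⟩ := ih
    refine ⟨K + 15, D + 1, fun X hX => ?_⟩
    have h1 := Nat.mul_le_mul_left X (h X hX)
    have h5 : 1 ≤ X ^ D := Nat.one_le_pow _ _ hX
    have h6 : X ≤ X * X ^ D := Nat.le_mul_of_pos_right _ h5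
    simp only [time, pow_succ]
    nlinarith

end Expression

/-! ### A language of commands with bounded loops -/

/-- Commands, built from assignments of expressions by means of conditionals and loops with a
number of rounds that is known in advance. -/
inductive Command where
  /-- `x := e` -/
  | assign (x : ℕ) (e : Expression) : Command
  /-- `A[i] := e` -/
  | store (A : ℕ) (i e : Expression) : Command
  /-- first `c`, then `c'` -/
  | seq (c c' : Command) : Command
  /-- `c`, provided that the value of `e` is not zero -/
  | when (e : Expression) (c : Command) : Command
  /-- `c` for each `x` from `0` to the content of register `r` minus one -/
  | loop (x r : ℕ) (c : Command) : Command

namespace Command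

/-- The effect of a command on the state. A loop reads its bound only once, at the beginning. -/
def run : Command → State → State
  | assign x e, σ => σ.setReg x (e.eval σ)
  | store A i e, σ => σ.setArr A (i.eval σ) (e.eval σ)
  | seq c c', σ => c'.run (c.run σ)
  | when e c, σ => if e.eval σ ≠ 0 then c.run σ else σ
  | loop x r c, σ => Nat.rec σ (fun i τ => c.run (τ.setReg x i)) (σ.reg r)

/-- The program of a command; the registers from `t` on serve as scratch memory. In the code of a
loop, register `t` counts the remaining rounds down, `t + 1` counts the finished rounds up, and
`t + 2` holds constants. -/
def code : Command → ℕ → Program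
  | assign x e, t => .seq (e.code t) <| .seq (.const (t + 1) 0) (.add x t (t + 1))
  | store A i e, t => .seq (i.code t) <| .seq (e.code (t + 1)) (.store A t (t + 1))
  | seq c c', t => .seq (c.code t) (c'.code t)
  | when e c, t => .seq (e.code t) (.ite t (c.code t) .skip)
  | loop x r c, t =>
    .seq (.const (t + 1) 0) <| .seq (.add t r (t + 1)) <|
    .loop t <|
      .seq (.const (t + 2) 0) <| .seq (.add x (t + 1) (t + 2)) <| .seq (c.code (t + 3)) <|
      .seq (.const (t + 2) 1) <| .seq (.add (t + 1) (t + 1) (t + 2)) (.sub t t (t + 2))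

/-- A bound on the running time of `code` when every loop has at most `X` rounds. -/
def time : Command → ℕ → ℕ
  | assign _ e, X => e.time X + 2
  | store _ i e, X => i.time X + (e.time X + 1)
  | seq c c', X => c.time X + c'.time X
  | when e c, X => e.time X + (c.time X + 2)
  | loop _ _ c, X => X * (c.time X + 6) + 3

/-- All registers of the command are below `W`, all sums and loops are bounded by registers in `R`,
and no register in `R` is changed. -/
def ok (W : ℕ) (R : List ℕ) : Command → Bool
  | assign x e => x.blt W && !R.contains x && e.ok W R
  | store _ i e => i.ok W R && e.ok W R
  | seq c c' => c.ok W R && c'.ok W R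
  | when e c => e.ok W R && c.ok W R
  | loop x r c => x.blt W && !R.contains x && R.contains r && r.blt W && c.ok W R

/-- The induction principle for loops: `I i` is an invariant for the state after `i` rounds. -/
theorem run_loop_induction {x r : ℕ} {c : Command} {σ : State} (I : ℕ → State → Prop)
    (h0 : I 0 σ) (hs : ∀ i τ, i < σ.reg r → I i τ → I (i + 1) (c.run (τ.setReg x i))) :
    I (σ.reg r) ((Command.loop x r c).run σ) := by
  have key : ∀ m ≤ σ.reg r,
      I m (Nat.rec σ (fun i τ => c.run (τ.setReg x i)) m : State) := by
    intro m hm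
    induction m with
    | zero => exact h0
    | succ m ih => exact hs m _ hm (ih (by omega))
  exact key _ le_rfl

theorem run_reg_of_mem {W : ℕ} {R : List ℕ} (c : Command) (hc : c.ok W R = true) {r : ℕ}
    (hr : r ∈ R) (σ : State) : (c.run σ).reg r = σ.reg r := by
  induction c generalizing σ with
  | assign x e =>
    simp only [ok, Bool.and_eq_true, Bool.not_eq_true', Bool.eq_false_iff, ne_eq,
      List.contains_iff_mem] at hc
    have : r ≠ x := fun h => hc.1.2 (h ▸ hr)
    simp [run, this]
  | store A i e => simp [run]
  | seq c c' ih ih' =>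
    simp only [ok, Bool.and_eq_true] at hc
    simp only [run, ih' hc.2, ih hc.1]
  | when e c ih =>
    simp only [ok, Bool.and_eq_true] at hc
    simp only [run]
    split_ifs
    · exact ih hc.2 σ
    · rfl
  | loop x r' c ih =>
    simp only [ok, Bool.and_eq_true, Bool.not_eq_true', Bool.eq_false_iff, ne_eq,
      List.contains_iff_mem] at hc
    have : r ≠ x := fun h => hc.1.1.1.2 (h ▸ hr)
    refine run_loop_induction (fun _ τ => τ.reg r = σ.reg r) rfl fun i τ _ h => ?_
    rw [ih hc.2]
    simp [this, h]

/-- The code of a command has the effect of the command, within the time bound. The state `s` of the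
machine need not be the state `σ` in which the effect is computed: what the scratch memory contains
is irrelevant. -/
theorem code_spec {W X : ℕ} {R : List ℕ} (c : Command) {σ s : State} {t : ℕ}
    (hc : c.ok W R = true) (ht : W ≤ t) (hσ : Agree W σ s)
    (hX : ∀ r < W, r ∈ R → σ.reg r ≤ X) :
    (c.code t).Achieves s (c.time X) fun s' =>
      Agree W (c.run σ) s' ∧ ∀ x, W ≤ x → x < t → s'.reg x = s.reg x := by
  induction c generalizing σ s t with
  | assign x e =>
    simp only [ok, Bool.and_eq_true, Nat.blt_eq] at hc
    refine Program.Achieves.seq (b' := 2) ((e.code_spec hc.2 ht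
      (fun r hr hR => (hσ.2 r hr) ▸ hX r hr hR)).mono le_rfl fun s' hs => ?_)
    obtain ⟨h1, h2, h3⟩ := hs
    refine Program.Achieves.seq (b := 1) (b' := 1) (Program.achieves_const
      (Program.achieves_add ⟨⟨hσ.1.trans h1.symm, fun y hy => ?_⟩, fun y hy hyt => ?_⟩))
    · have a1 : y ≠ t + 1 := by omega
      simp [run, a1, h3, h2 y (by omega), hσ.2 y hy, e.eval_congr hσ hc.2]
    · have a1 : y ≠ t + 1 := by omega
      have a2 : y ≠ x := by omega
      simp [a1, a2, h2 y hyt]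
  | store A i e =>
    simp only [ok, Bool.and_eq_true] at hc
    refine Program.Achieves.seq ((i.code_spec hc.1 ht
      (fun r hr hR => (hσ.2 r hr) ▸ hX r hr hR)).mono le_rfl fun s' hs => ?_)
    obtain ⟨h1, h2, h3⟩ := hs
    have hag : Agree W σ s' :=
      ⟨hσ.1.trans h1.symm, fun y hy => (hσ.2 y hy).trans (h2 y (by omega)).symm⟩
    refine Program.Achieves.seq ((e.code_spec (t := t + 1) hc.2 (by omega)
      (fun r hr hR => (hag.2 r hr) ▸ hX r hr hR)).mono le_rfl fun s'' hs => ?_)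
    obtain ⟨h4, h5, h6⟩ := hs
    refine Program.achieves_store ⟨⟨?_, fun y hy => ?_⟩, fun y hy hyt => ?_⟩
    · simp only [run, State.setArr, h6, h5 t (by omega), h3, h4, ← hag.1, e.eval_congr hag hc.2,
        i.eval_congr hσ hc.1]
    · simp [run, h5 y (by omega), hag.2 y hy]
    · simp [h5 y (by omega), h2 y hyt]
  | seq c c' ih ih' =>
    simp only [ok, Bool.and_eq_true] at hc
    refine Program.Achieves.seq ((ih hc.1 ht hσ hX).mono le_rfl fun s' hs => ?_)
    refine (ih' hc.2 ht hs.1 fun r hr hR => ?_).mono le_rfl fun s'' hs' =>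
      ⟨hs'.1, fun x hx hxt => (hs'.2 x hx hxt).trans (hs.2 x hx hxt)⟩
    rw [run_reg_of_mem c hc.1 hR]
    exact hX r hr hR
  | when e c ih =>
    simp only [ok, Bool.and_eq_true] at hc
    refine Program.Achieves.seq ((e.code_spec hc.1 ht
      (fun r hr hR => (hσ.2 r hr) ▸ hX r hr hR)).mono le_rfl fun s' hs => ?_)
    obtain ⟨h1, h2, h3⟩ := hs
    have hag : Agree W σ s' :=
      ⟨hσ.1.trans h1.symm, fun y hy => (hσ.2 y hy).trans (h2 y (by omega)).symm⟩
    rw [← e.eval_congr hσ hc.1] at h3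
    by_cases h0 : e.eval σ = 0
    · refine ⟨s', 1 + 1, .ite_false (h3.trans h0) (.skip _), by omega, ?_, fun x _ hxt => h2 x hxt⟩
      simpa [run, h0] using hag
    · obtain ⟨s'', T, h4, h5, h6, h7⟩ := ih hc.2 ht hag hX
      refine ⟨s'', T + 1, .ite_true (h3 ▸ h0) h4, by omega, ?_,
        fun x hx hxt => (h7 x hx hxt).trans (h2 x hxt)⟩
      simpa [run, h0] using h6
  | loop x r c ih =>
    simp only [ok, Bool.and_eq_true, Nat.blt_eq, Bool.not_eq_true', List.contains_iff_mem,
      Bool.eq_false_iff, ne_eq] at hc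
    obtain ⟨⟨⟨⟨hxW, hxR⟩, hrR⟩, hrW⟩, hc⟩ := hc
    have hr := hX r hrW hrR
    set m₀ := σ.reg r with hm₀
    let it : ℕ → State := fun m => Nat.rec σ (fun i τ => c.run (τ.setReg x i)) m
    have hit : ∀ m, ∀ r ∈ R, (it m).reg r = σ.reg r := by
      intro m r hr
      induction m with
      | zero => rfl
      | succ m ihm =>
        have : r ≠ x := fun h => hxR (h ▸ hr)
        change (c.run ((it m).setReg x m)).reg r = _
        rw [run_reg_of_mem c hc hr]
        simp [this, ihm]
    -- with `m` rounds to go, the machine agrees with the state after `m₀ - m` rounds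
    let I : ℕ → State → Prop := fun m τ => Agree W (it (m₀ - m)) τ ∧
      (∀ y, W ≤ y → y < t → τ.reg y = s.reg y) ∧ m ≤ m₀ ∧ τ.reg t = m ∧
      τ.reg (t + 1) = m₀ - m
    refine Program.Achieves.mono
      (b := 1 + (1 + (m₀ * (c.time X + 5 + 1) + 1))) (φ := I 0) ?_ ?_ fun s' hs => ?_
    · refine Program.Achieves.seq (Program.achieves_const ?_)
      refine Program.Achieves.seq (Program.achieves_add ?_)
      refine Program.achieves_loop I (fun m τ h => h.2.2.2.1) ?_ m₀ _ ?_
      · rintro m τ ⟨h1, h2, h3, h4, h5⟩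
        refine Program.Achieves.mono (b := 1 + (1 + (c.time X + (1 + (1 + 1)))))
          ?_ (by omega) fun _ h => h
        refine Program.Achieves.seq (Program.achieves_const ?_)
        refine Program.Achieves.seq (Program.achieves_add ?_)
        refine Program.Achieves.seq ((ih hc (t := t + 3)
          (σ := (it (m₀ - (m + 1))).setReg x (m₀ - (m + 1))) (by omega) ?_ ?_).mono le_rfl
          fun s' hs => ?_)
        · refine ⟨h1.1, fun y hy => ?_⟩
          have a1 : y ≠ t + 2 := by omega
          simp [a1, h5, h1.2 y hy]
        · intro r' hr' hR'
          have : r' ≠ x := fun h => hxR (h ▸ hR')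
          simpa [this, hit _ r' hR'] using hX r' hr' hR'
        obtain ⟨h6, h7⟩ := hs
        refine Program.Achieves.seq (Program.achieves_const ?_)
        refine Program.Achieves.seq (Program.achieves_add ?_)
        refine Program.achieves_sub ?_
        have e1 : m₀ - m = (m₀ - (m + 1)) + 1 := by omega
        have n1 : t + 1 ≠ x := by omega
        have n2 : t ≠ x := by omega
        refine ⟨⟨?_, fun y hy => ?_⟩, fun y hy hyt => ?_, by omega, ?_, ?_⟩
        · rw [e1]
          exact h6.1
        · have a1 : y ≠ t + 1 := by omega
          have a2 : y ≠ t + 2 := by omega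
          have a3 : y ≠ t := by omega
          rw [e1]
          simpa [a1, a2, a3] using h6.2 y hy
        · have a1 : y ≠ t + 1 := by omega
          have a2 : y ≠ t + 2 := by omega
          have a3 : y ≠ x := by omega
          simp [a1, a2, hyt.ne, h7 y hy (by omega), a3, h2 y hy hyt]
        · simp [h7 t (by omega) (by omega), n2, h4]
        · simp [h7 (t + 1) (by omega) (by omega), n1, h5]
          omega
      · have a1 : r ≠ t + 1 := by omega
        refine ⟨⟨?_, fun y hy => ?_⟩, fun y hy hyt => ?_, le_rfl, ?_, ?_⟩
        · rw [Nat.sub_self]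
          exact hσ.1
        · have a1 : y ≠ t + 1 := by omega
          have a2 : y ≠ t := by omega
          rw [Nat.sub_self]
          simpa [a1, a2, it] using hσ.2 y hy
        · have a1 : y ≠ t + 1 := by omega
          simp [a1, hyt.ne]
        · simp [a1, hm₀, hσ.2 r hrW]
        · simp
    · have : m₀ * (c.time X + 5 + 1) ≤ X * (c.time X + 6) := Nat.mul_le_mul_right _ hr
      simp only [time]
      omega
    · exact ⟨hs.1, hs.2.1⟩

theorem exists_time_le (c : Command) : ∃ K D : ℕ, ∀ X, 1 ≤ X → c.time X ≤ K * X ^ D := by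
  induction c with
  | assign x e =>
    obtain ⟨K, D, h⟩ := e.exists_time_le
    refine ⟨K + 2, D, fun X hX => ?_⟩
    have h1 := h X hX
    have h5 : 1 ≤ X ^ D := Nat.one_le_pow _ _ hX
    simp only [time]
    nlinarith
  | store A i e =>
    obtain ⟨K, D, h⟩ := (Expression.add i e).exists_time_le
    exact ⟨K, D, h⟩
  | seq c c' ih ih' =>
    obtain ⟨K, D, h⟩ := ih
    obtain ⟨K', D', h'⟩ := ih'
    refine ⟨K + K', D + D', fun X hX => ?_⟩
    have h3 : X ^ D ≤ X ^ (D + D') := Nat.pow_le_pow_right hX (by omega)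
    have h4 : X ^ D' ≤ X ^ (D + D') := Nat.pow_le_pow_right hX (by omega)
    rw [time, add_mul]
    exact add_le_add ((h X hX).trans (Nat.mul_le_mul_left K h3))
      ((h' X hX).trans (Nat.mul_le_mul_left K' h4))
  | when e c ih =>
    obtain ⟨K, D, h⟩ := ih
    obtain ⟨K', D', h'⟩ := e.exists_time_le
    refine ⟨K + K' + 2, D + D', fun X hX => ?_⟩
    have h1 := h X hX
    have h2 := h' X hX
    have h3 : X ^ D ≤ X ^ (D + D') := Nat.pow_le_pow_right hX (by omega)
    have h4 : X ^ D' ≤ X ^ (D + D') := Nat.pow_le_pow_right hX (by omega)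
    have h5 : 1 ≤ X ^ (D + D') := Nat.one_le_pow _ _ hX
    simp only [time]
    nlinarith [Nat.mul_le_mul_left K h3, Nat.mul_le_mul_left K' h4]
  | loop x r c ih =>
    obtain ⟨K, D, h⟩ := ih
    refine ⟨K + 9, D + 1, fun X hX => ?_⟩
    have h1 := Nat.mul_le_mul_left X (h X hX)
    have h5 : 1 ≤ X ^ D := Nat.one_le_pow _ _ hX
    have h6 : X ≤ X * X ^ D := Nat.le_mul_of_pos_right _ h5
    simp only [time, pow_succ]
    nlinarith

end Command

end RAM

/-! ### Graphs without a complete bipartite subgraph -/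

namespace Dilation

section Combinatorics

open Finset
open scoped Classical

variable {V : Type*} [Fintype V] [LinearOrder V]

omit [Fintype V] [LinearOrder V] in
theorem BicliqueFree.card_lt_of_forall_adj {d : ℕ} {G : SimpleGraph V} (h : BicliqueFree d G)
    {X Y : Finset V} (hX : d ≤ #X) (hXY : ∀ x ∈ X, ∀ y ∈ Y, G.Adj x y) : #Y < d := by
  by_contra! hY
  obtain ⟨f⟩ : Nonempty (Fin d ↪ X) :=
    Function.Embedding.nonempty_of_card_le (by simpa using hX)
  obtain ⟨g⟩ : Nonempty (Fin d ↪ Y) :=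
    Function.Embedding.nonempty_of_card_le (by simpa using hY)
  have hfg (i j : Fin d) : G.Adj (f i) (g j) := hXY _ (f i).2 _ (g j).2
  refine h ⟨⟨⟨Sum.elim (fun i => f i) (fun i => g i), ?_⟩, ?_⟩⟩
  · rintro (i | i) (j | j) hij
    · simp at hij
    · exact hfg i j
    · exact (hfg j i).symm
    · simp at hij
  · rintro (i | i) (j | j) hij
    · exact congrArg _ (f.injective (Subtype.ext hij))
    · exact absurd hij (hfg i j).ne
    · exact absurd hij (hfg j i).ne'
    · exact congrArg _ (g.injective (Subtype.ext hij))

omit [Fintype V] in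
/-- In a graph without `K_{d,d}`, only boundedly many vertices are adjacent to a `k`-th part
of a large set `A` (up to an additive error). Otherwise, by double counting, many members of `A` have
`d` neighbours among these vertices, and many of them have the same neighbours. -/
theorem BicliqueFree.card_le_of_forall_card_le {d k N : ℕ} {G : SimpleGraph V}
    (h : BicliqueFree d G) (hN : 4 * (k + 1) * (d + 1) ≤ N) {A W : Finset V}
    (hA : N * 2 ^ N ≤ #A) (hW : ∀ w ∈ W, #A ≤ k * #{v ∈ A | G.Adj w v} + 2 * k) : #W ≤ N := by
  by_contra! hNW
  obtain ⟨W', hW', hcard⟩ := exists_subset_card_eq hNW.le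
  -- the members of `A` with at least `d` neighbours in `W'`
  set g := #{v ∈ A | d ≤ #{w ∈ W' | G.Adj w v}} with hg
  have hcount : ∑ w ∈ W', #{v ∈ A | G.Adj w v} = ∑ v ∈ A, #{w ∈ W' | G.Adj w v} :=
    sum_card_bipartiteAbove_eq_sum_card_bipartiteBelow G.Adj
  have hupper : ∑ v ∈ A, #{w ∈ W' | G.Adj w v} ≤ g * N + #A * d := by
    calc ∑ v ∈ A, #{w ∈ W' | G.Adj w v}
        ≤ ∑ v ∈ A, ((if d ≤ #{w ∈ W' | G.Adj w v} then N else 0) + d) := by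
          refine sum_le_sum fun v _ => ?_
          split_ifs with hd
          · exact (card_filter_le _ _).trans (by omega)
          · omega
      _ = g * N + #A * d := by
          rw [sum_add_distrib, ← sum_filter, sum_const, sum_const, smul_eq_mul, smul_eq_mul]
  have hlower : N * #A ≤ k * (∑ w ∈ W', #{v ∈ A | G.Adj w v}) + N * (2 * k) := by
    calc N * #A = ∑ w ∈ W', #A := by rw [sum_const, hcard, smul_eq_mul]
      _ ≤ ∑ w ∈ W', (k * #{v ∈ A | G.Adj w v} + 2 * k) := sum_le_sum fun w hw => hW w (hW' hw)
      _ = _ := by rw [sum_add_distrib, ← mul_sum, sum_const, hcard, smul_eq_mul]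
  have hNpos : 0 < N := lt_of_lt_of_le (by positivity) hN
  have h2N : N ≤ 2 ^ N := Nat.lt_two_pow_self.le
  have hkd : 4 * (k * d) ≤ N := le_trans (by nlinarith) hN
  have hk8 : 8 * k ≤ #A := by
    have : 4 * k + 4 ≤ N := le_trans (by nlinarith) hN
    nlinarith
  have hgood : #A ≤ 2 * k * g := by
    have h1 : N * #A ≤ k * (g * N + #A * d) + N * (2 * k) :=
      hlower.trans (Nat.add_le_add_right (Nat.mul_le_mul_left _ (hcount ▸ hupper)) _)
    have h2 : 4 * (k * d) * #A ≤ N * #A := Nat.mul_le_mul_right _ hkd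
    have h3 : N * (8 * k) ≤ N * #A := Nat.mul_le_mul_left _ hk8
    have h4 : N * #A ≤ N * (2 * k * g) := by nlinarith
    exact Nat.le_of_mul_le_mul_left h4 hNpos
  have hk : 0 < k := by
    rcases Nat.eq_zero_or_pos k with rfl | hk
    · have : 0 < N * 2 ^ N := by positivity
      omega
    · exact hk
  have hpig : #W'.powerset * d ≤ #{v ∈ A | d ≤ #{w ∈ W' | G.Adj w v}} := by
    rw [card_powerset, hcard, ← hg]
    have h1 : 4 * (k * d) * 2 ^ N ≤ #A := (Nat.mul_le_mul_right _ hkd).trans hA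
    have h2 : (2 * k) * (2 ^ N * d) ≤ (2 * k) * g := by nlinarith
    exact Nat.le_of_mul_le_mul_left h2 (by omega)
  -- at least `d` members of `A` have the same set `Y` of neighbours in `W'`
  obtain ⟨Y, -, hYd⟩ := exists_le_card_fiber_of_mul_le_card_of_maps_to
    (f := fun v => {w ∈ W' | G.Adj w v}) (fun v _ => mem_powerset.2 (filter_subset _ _))
    ⟨∅, empty_mem_powerset _⟩ hpig
  rcases Nat.eq_zero_or_pos d with rfl | hd
  · exact absurd (h.card_lt_of_forall_adj (X := ∅) (Y := ∅) le_rfl (by simp)) (by simp)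
  obtain ⟨v, hv⟩ := card_pos.1 (hd.trans_le hYd)
  simp only [mem_filter] at hv
  refine absurd (h.card_lt_of_forall_adj (Y := Y) hYd fun x hx y hy => ?_)
    (not_lt.2 (hv.2 ▸ hv.1.2))
  simp only [mem_filter] at hx
  rw [← hx.2] at hy
  exact (mem_filter.1 hy).2.symm

/-! ### Conflicts -/

/-- The edge `uv` of `Γ` is a conflict of the subgraph `E` of `Γ` if `E` joins its ends neither by
an edge nor by a path with two edges. -/
def Conflict (Γ E : SimpleGraph V) (u v : V) : Prop :=
  Γ.Adj u v ∧ ¬ E.Adj u v ∧ ∀ w, ¬ (E.Adj u w ∧ E.Adj w v)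

/-- The vertices that form a conflict with `u`. -/
noncomputable def conflicts (Γ E : SimpleGraph V) (u : V) : Finset V :=
  {v | Conflict Γ E u v}

/-- The vertices that take part in a conflict. -/
noncomputable def conflictVerts (Γ E : SimpleGraph V) : Finset V :=
  {z | (conflicts Γ E z).Nonempty}

/-- Adding the edges in `T` to `E` leaves no conflict. -/
def Resolves (Γ E : SimpleGraph V) (T : Finset (Sym2 V)) : Prop :=
  ∀ u v, ¬ Conflict Γ (E ⊔ SimpleGraph.fromEdgeSet (T : Set (Sym2 V))) u v

/-- The vertices that are ends of an edge in `T`. -/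
noncomputable def ends (T : Finset (Sym2 V)) : Finset V := T.biUnion Sym2.toFinset

variable {Γ E G : SimpleGraph V} {S T : Finset (Sym2 V)} {k d M N : ℕ} {u v w z : V}

omit [LinearOrder V] in
theorem mem_conflicts : v ∈ conflicts Γ E u ↔ Conflict Γ E u v := by simp [conflicts]

omit [LinearOrder V] in
theorem mem_conflictVerts : z ∈ conflictVerts Γ E ↔ ∃ v, Conflict Γ E z v := by
  simp [conflictVerts, Finset.Nonempty, mem_conflicts]

omit [Fintype V] [LinearOrder V] in
theorem Conflict.symm (h : Conflict Γ E u v) : Conflict Γ E v u :=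
  ⟨h.1.symm, fun h' => h.2.1 h'.symm, fun w hw => h.2.2 w ⟨hw.2.symm, hw.1.symm⟩⟩

omit [Fintype V] [LinearOrder V] in
theorem Conflict.anti {E' : SimpleGraph V} (hE : E ≤ E') (h : Conflict Γ E' u v) :
    Conflict Γ E u v :=
  ⟨h.1, fun h' => h.2.1 (hE h'), fun w hw => h.2.2 w ⟨hE hw.1, hE hw.2⟩⟩

omit [Fintype V] [LinearOrder V] in
theorem sup_fromEdgeSet_adj (hT : (T : Set (Sym2 V)) ⊆ Γ.edgeSet) :
    (E ⊔ SimpleGraph.fromEdgeSet (T : Set (Sym2 V))).Adj u v ↔ E.Adj u v ∨ s(u, v) ∈ T := by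
  rw [SimpleGraph.sup_adj, SimpleGraph.fromEdgeSet_adj, mem_coe]
  refine or_congr_right ⟨And.left, fun h => ⟨h, ?_⟩⟩
  have : Γ.Adj u v := hT h
  exact this.ne

omit [Fintype V] in
theorem mem_ends : z ∈ ends T ↔ ∃ e ∈ T, z ∈ e := by simp [ends]

omit [Fintype V] in
theorem card_ends_le (T : Finset (Sym2 V)) : #(ends T) ≤ 2 * #T := by
  rw [mul_comm]
  refine card_biUnion_le_card_mul _ _ _ fun e _ => ?_
  rw [Sym2.card_toFinset]
  split_ifs <;> omega

omit [Fintype V] [LinearOrder V] in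
/-- A resolved conflict `uv` is a new edge, or there is a path `u w v` of old and new edges. -/
theorem Resolves.exists_mem (hR : Resolves Γ E T) (hT : (T : Set (Sym2 V)) ⊆ Γ.edgeSet)
    (h : Conflict Γ E u v) :
    s(u, v) ∈ T ∨ ∃ w, (E.Adj u w ∨ s(u, w) ∈ T) ∧ (E.Adj w v ∨ s(w, v) ∈ T) := by
  by_contra! hcon
  refine hR u v ⟨h.1, fun h' => ?_, fun w hw => ?_⟩
  · rcases (sup_fromEdgeSet_adj hT).1 h' with h' | h'
    · exact h.2.1 h'
    · exact hcon.1 h'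
  · rw [sup_fromEdgeSet_adj hT, sup_fromEdgeSet_adj hT] at hw
    have := hcon.2 w
    tauto

omit [Fintype V] in
theorem Resolves.mem_ends_or (hR : Resolves Γ E T) (hT : (T : Set (Sym2 V)) ⊆ Γ.edgeSet)
    (h : Conflict Γ E u v) : u ∈ ends T ∨ v ∈ ends T := by
  simp only [mem_ends]
  rcases hR.exists_mem hT h with h' | ⟨w, h1 | h1, h2 | h2⟩
  · exact Or.inl ⟨_, h', by simp⟩
  · exact absurd ⟨h1, h2⟩ (h.2.2 w)
  · exact Or.inr ⟨_, h2, by simp⟩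
  · exact Or.inl ⟨_, h1, by simp⟩
  · exact Or.inl ⟨_, h1, by simp⟩

/-- If `u` takes part in many conflicts, then most of them are resolved by a new edge `uw`, followed
by an edge of `G`; hence `u` is joined to a vertex `w` with many neighbours in `conflicts Γ E u`. -/
theorem Resolves.exists_mem_of_card_conflicts
    (hE : E = (G ⊓ Γ) ⊔ SimpleGraph.fromEdgeSet (S : Set (Sym2 V)))
    (hS : (S : Set (Sym2 V)) ⊆ Γ.edgeSet) (hT : (T : Set (Sym2 V)) ⊆ Γ.edgeSet)
    (hk : #S + #T ≤ k) (hR : Resolves Γ E T) (hu : 2 * k < #(conflicts Γ E u)) :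
    ∃ w, s(u, w) ∈ T ∧
      #(conflicts Γ E u) ≤ k * #{v ∈ conflicts Γ E u | G.Adj w v} + 2 * k := by
  set A := conflicts Γ E u with hA
  set W : Finset V := {w | s(u, w) ∈ T} with hW
  have hWk : #W ≤ k := by
    have : #W ≤ #T := card_le_card_of_injOn (fun w => s(u, w)) (by simp [hW, Set.MapsTo])
      (fun a _ b _ hab => Sym2.congr_right.1 hab)
    omega
  have hcover : A ⊆ (ends S ∪ ends T) ∪ W.biUnion fun w => {v ∈ A | G.Adj w v} := by
    intro v hv
    by_cases hvS : v ∈ ends S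
    · simp [hvS]
    by_cases hvT : v ∈ ends T
    · simp [hvT]
    rw [hA, mem_conflicts] at hv
    have hvT' : ∀ x, s(x, v) ∉ T := fun x hx => hvT (mem_ends.2 ⟨_, hx, by simp⟩)
    have hvS' : ∀ x, s(x, v) ∉ S := fun x hx => hvS (mem_ends.2 ⟨_, hx, by simp⟩)
    rcases hR.exists_mem hT hv with h | ⟨w, h1, h2⟩
    · exact absurd h (hvT' u)
    have h2 := h2.resolve_right (hvT' w)
    have h1 := h1.resolve_left fun h1 => hv.2.2 w ⟨h1, h2⟩
    rw [hE, sup_fromEdgeSet_adj hS] at h2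
    have h3 := (h2.resolve_right (hvS' w)).1
    simp only [mem_union, mem_biUnion]
    exact Or.inr ⟨w, by simp [hW, h1], by simp [hA, mem_conflicts, hv, h3]⟩
  have hsum : #A ≤ 2 * k + ∑ w ∈ W, #{v ∈ A | G.Adj w v} := by
    refine (card_le_card hcover).trans ((card_union_le _ _).trans (add_le_add ?_ card_biUnion_le))
    have h1 := card_ends_le S
    have h2 := card_ends_le T
    exact (card_union_le _ _).trans (by omega)
  -- otherwise, summing up the bounds for the vertices in `W` contradicts `hsum`
  by_contra! hcon
  have hWne : W.Nonempty := by
    rw [nonempty_iff_ne_empty]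
    rintro h0
    rw [h0, sum_empty] at hsum
    omega
  have h1 : ∑ w ∈ W, (k * #{v ∈ A | G.Adj w v} + 2 * k) < ∑ w ∈ W, #A :=
    sum_lt_sum_of_nonempty hWne fun w hw => hcon w (by simpa [hW] using hw)
  rw [sum_add_distrib, ← mul_sum, sum_const, sum_const, smul_eq_mul, smul_eq_mul] at h1
  obtain ⟨a, ha⟩ := Nat.exists_eq_add_of_lt hu
  have h2 : #W * (a + 1) ≤ k * (a + 1) := Nat.mul_le_mul_right _ hWk
  have h3 : k * (a + 1) ≤ k * ∑ w ∈ W, #{v ∈ A | G.Adj w v} :=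
    Nat.mul_le_mul_left _ (by omega)
  rw [ha] at h1
  nlinarith

/-- The ends of the new edges cover all conflicts. -/
theorem Resolves.card_conflictVerts_le (hR : Resolves Γ E T)
    (hT : (T : Set (Sym2 V)) ⊆ Γ.edgeSet) (hk : #T ≤ k)
    (hM : ∀ u, #(conflicts Γ E u) < M) : #(conflictVerts Γ E) ≤ 2 * k + 2 * k * M := by
  have hcover : conflictVerts Γ E ⊆ ends T ∪ (ends T).biUnion (conflicts Γ E) := by
    intro z hz
    obtain ⟨v, hv⟩ := mem_conflictVerts.1 hz
    rw [mem_union, mem_biUnion]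
    exact (hR.mem_ends_or hT hv).imp id fun h => ⟨v, h, mem_conflicts.2 hv.symm⟩
  have hends : #(ends T) ≤ 2 * k := (card_ends_le T).trans (by omega)
  refine (card_le_card hcover).trans ((card_union_le _ _).trans (add_le_add hends ?_))
  exact (card_biUnion_le_card_mul _ _ M fun u _ => (hM u).le).trans (Nat.mul_le_mul_right _ hends)

/-! ### Vertices of the same type -/

/-- Two vertices have the same type if they have the same neighbours, both in `Γ` and in `E`,
among the vertices that take part in a conflict. -/
def SameType (Γ E : SimpleGraph V) (w w' : V) : Prop :=
  ∀ z ∈ conflictVerts Γ E, (Γ.Adj z w ↔ Γ.Adj z w') ∧ (E.Adj z w ↔ E.Adj z w')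

/-- The first vertex of its type. -/
def IsRepresentative (Γ E : SimpleGraph V) (w : V) : Prop :=
  ∀ w' < w, ¬ SameType Γ E w w'

theorem exists_sameType_isRepresentative (Γ E : SimpleGraph V) (w : V) :
    ∃ w', SameType Γ E w w' ∧ IsRepresentative Γ E w' := by
  obtain ⟨m, hm, hmin⟩ := exists_min_image ({x | SameType Γ E w x} : Finset V) id
    ⟨w, by rw [mem_filter_univ]; exact fun z _ => ⟨Iff.rfl, Iff.rfl⟩⟩
  rw [mem_filter_univ] at hm
  refine ⟨m, hm, fun x hx hmx => ?_⟩
  have : m ≤ x := hmin x (by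
    rw [mem_filter_univ]
    exact fun z hz => ⟨(hm z hz).1.trans (hmx z hz).1, (hm z hz).2.trans (hmx z hz).2⟩)
  exact absurd hx (not_lt.2 this)

theorem card_filter_isRepresentative_le (Γ E : SimpleGraph V) :
    #{w | IsRepresentative Γ E w} ≤ 4 ^ #(conflictVerts Γ E) := by
  set Z := conflictVerts Γ E
  have : #{w | IsRepresentative Γ E w} ≤ #(Z.powerset ×ˢ Z.powerset) := by
    refine card_le_card_of_injOn (fun w => ({z ∈ Z | Γ.Adj z w}, {z ∈ Z | E.Adj z w}))
      (fun w _ => mem_product.2 ⟨mem_powerset.2 (filter_subset _ _),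
        mem_powerset.2 (filter_subset _ _)⟩) fun a ha b hb hab => ?_
    rw [mem_coe, mem_filter_univ] at ha hb
    have hs : SameType Γ E a b := by
      intro z hz
      have h1 := congrArg (fun p => z ∈ p.1) hab
      have h2 := congrArg (fun p => z ∈ p.2) hab
      simpa [Z, hz] using And.intro h1 h2
    rcases lt_trichotomy a b with h | h | h
    · exact absurd (fun z hz => ⟨(hs z hz).1.symm, (hs z hz).2.symm⟩) (hb a h)
    · exact h
    · exact absurd hs (ha b h)
  refine this.trans_eq ?_
  rw [card_product, card_powerset, ← mul_pow]
  norm_num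

/-- A solution can be rearranged so that every new edge joins a vertex with a conflict to a vertex
that has a conflict or is the first of its type: move the end without conflict
to the first vertex of its type. -/
theorem Resolves.exists_rearranged (hR : Resolves Γ E T)
    (hT : (T : Set (Sym2 V)) ⊆ Γ.edgeSet) :
    ∃ T' : Finset (Sym2 V), (T' : Set (Sym2 V)) ⊆ Γ.edgeSet ∧ #T' ≤ #T ∧ Resolves Γ E T' ∧
      ∀ e ∈ T', ∃ z x, e = s(z, x) ∧ z ∈ conflictVerts Γ E ∧
        (x ∈ conflictVerts Γ E ∨ IsRepresentative Γ E x) := by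
  set Z := conflictVerts Γ E with hZ
  have hφ : ∀ w, ∃ w', (w ∈ Z → w' = w) ∧ SameType Γ E w w' ∧
      (w' ∈ Z ∨ IsRepresentative Γ E w') := by
    intro w
    by_cases hw : w ∈ Z
    · exact ⟨w, fun _ => rfl, by simp [SameType], Or.inl hw⟩
    · obtain ⟨w', h1, h2⟩ := exists_sameType_isRepresentative Γ E w
      exact ⟨w', fun h => absurd h hw, h1, Or.inr h2⟩
  choose φ hfix htype hrep using hφ
  set T' := ({e ∈ T | ∃ z ∈ Z, z ∈ e} : Finset (Sym2 V)).image (Sym2.map φ) with hT'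
  have hmem : ∀ z ∈ Z, ∀ w, s(z, w) ∈ T → s(z, φ w) ∈ T' := by
    intro z hz w hzw
    refine mem_image.2 ⟨s(z, w), mem_filter.2 ⟨hzw, z, hz, by simp⟩, ?_⟩
    rw [Sym2.map_mk, hfix z hz]
  have hform : ∀ e ∈ T', ∃ z ∈ Z, ∃ w, s(z, w) ∈ T ∧ e = s(z, φ w) := by
    intro e he
    obtain ⟨e₀, h₀, rfl⟩ := mem_image.1 he
    obtain ⟨h₀, z, hz, hze⟩ := mem_filter.1 h₀
    obtain ⟨w, rfl⟩ := Sym2.mem_iff_exists.1 hze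
    exact ⟨z, hz, w, h₀, by rw [Sym2.map_mk, hfix z hz]⟩
  have hT'Γ : (T' : Set (Sym2 V)) ⊆ Γ.edgeSet := by
    intro e he
    obtain ⟨z, hz, w, hzw, rfl⟩ := hform e he
    exact (htype w z hz).1.1 (hT hzw)
  refine ⟨T', hT'Γ, card_image_le.trans (card_filter_le _ _), fun u v huv => ?_, fun e he => ?_⟩
  · have hE := huv.anti (le_sup_left (a := E))
    have hu : u ∈ Z := mem_conflictVerts.2 ⟨v, hE⟩
    have hv : v ∈ Z := mem_conflictVerts.2 ⟨u, hE.symm⟩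
    rcases hR.exists_mem hT hE with h | ⟨w, h1, h2⟩
    · refine huv.2.1 ((sup_fromEdgeSet_adj hT'Γ).2 (Or.inr ?_))
      simpa [hfix v hv] using hmem u hu v h
    · refine huv.2.2 (φ w) ⟨(sup_fromEdgeSet_adj hT'Γ).2 ?_, ?_⟩
      · exact h1.imp (htype w u hu).2.1 (hmem u hu w)
      · refine ((sup_fromEdgeSet_adj hT'Γ).2 ?_).symm
        rw [SimpleGraph.adj_comm, Sym2.eq_swap] at h2
        exact h2.imp (htype w v hv).2.1 (hmem v hv w)
  · obtain ⟨z, hz, w, -, rfl⟩ := hform e he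
    exact ⟨z, φ w, rfl, hz, hrep w⟩

/-! ### The candidates for a new edge -/

/-- The candidates for the first end of a new edge: the vertices with at least `M` conflicts if
there are any, otherwise all vertices with a conflict. -/
def IsFirstEnd (M : ℕ) (Γ E : SimpleGraph V) (u : V) : Prop :=
  0 < #(conflicts Γ E u) ∧ (M ≤ #(conflicts Γ E u) ∨ ∀ v, #(conflicts Γ E v) < M)

/-- The candidates for the second end of a new edge with first end `u`: if `u` has many conflicts,
then the vertices with sufficiently many neighbours among them, otherwise the vertices with a
conflict and the first vertices of the types. -/
def IsSecondEnd (k M : ℕ) (G Γ E : SimpleGraph V) (u w : V) : Prop :=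
  (M ≤ #(conflicts Γ E u) ∧
    #(conflicts Γ E u) ≤ k * #{v ∈ conflicts Γ E u | G.Adj w v} + 2 * k) ∨
  (#(conflicts Γ E u) < M ∧ (0 < #(conflicts Γ E w) ∨ IsRepresentative Γ E w))

/-- The vertex `u` satisfies `p`, and exactly `c` smaller vertices do. -/
def IsNth (p : V → Prop) (c : ℕ) (u : V) : Prop :=
  p u ∧ #{v | v < u ∧ p v} = c

theorem IsNth.unique {p : V → Prop} {c : ℕ} {u v : V} (hu : IsNth p c u) (hv : IsNth p c v) :
    u = v := by
  have key : ∀ {a b : V}, IsNth p c a → IsNth p c b → ¬ a < b := by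
    intro a b ha hb hab
    refine absurd (hb.2.trans ha.2.symm) (card_lt_card ⟨fun x hx => ?_, fun h => ?_⟩).ne'
    · rw [mem_filter_univ] at hx ⊢
      exact ⟨hx.1.trans hab, hx.2⟩
    · have := h (mem_filter.2 ⟨mem_univ a, hab, ha.1⟩)
      simp at this
  exact le_antisymm (not_lt.1 (key hv hu)) (not_lt.1 (key hu hv))

theorem exists_isNth_of_card_le {p : V → Prop} {B : ℕ} (hB : #{v | p v} ≤ B) {u : V} (hu : p u) :
    ∃ c < B, IsNth p c u := by
  refine ⟨_, lt_of_lt_of_le (card_lt_card ⟨fun x hx => ?_, fun h => ?_⟩) hB, hu, rfl⟩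
  · rw [mem_filter_univ] at hx ⊢
    exact hx.2
  · have := h (mem_filter.2 ⟨mem_univ u, hu⟩)
    simp at this

/-- The auxiliary parameter `2 ^ (k + d + 2)`. -/
def paramN (k d : ℕ) : ℕ := 2 ^ (k + d + 2)

/-- The number of conflicts from which on a vertex has many of them. -/
def paramM (k d : ℕ) : ℕ := 2 ^ (2 * paramN k d)

/-- A bound on the number of vertices with a conflict, when no vertex has many of them. -/
def paramQ (k d : ℕ) : ℕ := 2 ^ (4 * paramN k d)

/-- A bound on the number of candidates for each end of a new edge. -/
def paramB (k d : ℕ) : ℕ := 2 ^ (4 * paramQ k d)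

theorem four_mul_le_paramN (k d : ℕ) : 4 * (k + 1) * (d + 1) ≤ paramN k d := by
  have h1 : k + 1 ≤ 2 ^ k := Nat.lt_two_pow_self
  have h2 : d + 1 ≤ 2 ^ d := Nat.lt_two_pow_self
  calc 4 * (k + 1) * (d + 1) ≤ 4 * 2 ^ k * 2 ^ d := by gcongr
    _ = paramN k d := by rw [paramN, pow_add, pow_add]; ring

theorem four_mul_le_paramM (k d : ℕ) : 4 * (k + 1) ≤ paramM k d := by
  have h1 := four_mul_le_paramN k d
  have h2 : paramN k d < 2 ^ paramN k d := Nat.lt_two_pow_self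
  have h3 : 2 ^ paramN k d ≤ paramM k d := Nat.pow_le_pow_right (by omega) (by omega)
  nlinarith

theorem paramN_mul_le_paramM (k d : ℕ) : paramN k d * 2 ^ paramN k d ≤ paramM k d := by
  rw [paramM, two_mul, pow_add]
  exact Nat.mul_le_mul_right _ Nat.lt_two_pow_self.le

theorem paramM_mul_self (k d : ℕ) : paramM k d * paramM k d = paramQ k d := by
  rw [paramM, paramQ, ← pow_add]
  congr 1
  omega

theorem le_paramQ (k d : ℕ) : 2 * k + 2 * k * paramM k d ≤ paramQ k d := by
  have := four_mul_le_paramM k d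
  rw [← paramM_mul_self]
  nlinarith

theorem paramQ_add_le_paramB (k d : ℕ) : paramQ k d + 4 ^ paramQ k d ≤ paramB k d := by
  have h1 : paramQ k d < 4 ^ paramQ k d := Nat.lt_pow_self (by omega)
  have h2 : paramB k d = 4 ^ paramQ k d * 4 ^ paramQ k d := by
    rw [paramB, ← mul_pow, pow_mul]
    norm_num
  rw [h2]
  nlinarith

theorem paramN_le_paramB (k d : ℕ) : paramN k d ≤ paramB k d := by
  have h1 : paramN k d < 2 ^ paramN k d := Nat.lt_two_pow_self
  have h2 : 2 ^ paramN k d ≤ paramQ k d := Nat.pow_le_pow_right (by omega) (by omega)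
  have h3 : paramQ k d ≤ paramB k d := (Nat.le_add_right _ _).trans (paramQ_add_le_paramB k d)
  omega

/-- As long as there is a conflict, some solution that is not larger than `T` contains an edge from
one of the first `paramB k d` candidates for the first end to one of the first `paramB k d`
candidates for the second end. Here `S` is the set of edges that were added before. -/
theorem Resolves.exists_candidate (hG : BicliqueFree d G)
    (hE : E = (G ⊓ Γ) ⊔ SimpleGraph.fromEdgeSet (S : Set (Sym2 V)))
    (hS : (S : Set (Sym2 V)) ⊆ Γ.edgeSet) (hT : (T : Set (Sym2 V)) ⊆ Γ.edgeSet)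
    (hk : #S + #T ≤ k) (hR : Resolves Γ E T) (huv : Conflict Γ E u v) :
    ∃ a b, ∃ T' : Finset (Sym2 V), (T' : Set (Sym2 V)) ⊆ Γ.edgeSet ∧ #T' ≤ #T ∧
      Resolves Γ E T' ∧ s(a, b) ∈ T' ∧
      (∃ c < paramB k d, IsNth (IsFirstEnd (paramM k d) Γ E) c a) ∧
      (∃ c < paramB k d, IsNth (IsSecondEnd k (paramM k d) G Γ E a) c b) := by
  have hM := four_mul_le_paramM k d
  have hB : 0 < paramB k d := by simp [paramB]
  by_cases hbig : ∃ u, paramM k d ≤ #(conflicts Γ E u)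
  · obtain ⟨a, ha, hmin⟩ := exists_min_image
      ({u | paramM k d ≤ #(conflicts Γ E u)} : Finset V) id
      (by obtain ⟨u, hu⟩ := hbig; exact ⟨u, by simpa using hu⟩)
    rw [mem_filter_univ] at ha
    obtain ⟨b, hab, hb⟩ := hR.exists_mem_of_card_conflicts hE hS hT hk (u := a) (by omega)
    -- every vertex with many conflicts is an end of a new edge, so the first one may be chosen
    refine ⟨a, b, T, hT, le_rfl, hR, hab, ⟨0, hB, ⟨by omega, Or.inl ha⟩, ?_⟩, ?_⟩
    · rw [card_eq_zero, filter_eq_empty_iff]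
      rintro x - ⟨hxa, -, hx | hx⟩
      · exact absurd hxa (not_lt.2 (hmin x (by simpa using hx)))
      · exact absurd (hx a) (not_lt.2 ha)
    · refine exists_isNth_of_card_le (le_trans ?_ (paramN_le_paramB k d)) (Or.inl ⟨ha, hb⟩)
      refine hG.card_le_of_forall_card_le (four_mul_le_paramN k d)
        ((paramN_mul_le_paramM k d).trans ha) fun w hw => ?_
      rw [mem_filter_univ] at hw
      rcases hw with hw | hw
      · exact hw.2
      · exact absurd hw.1 (not_lt.2 ha)
  · push Not at hbig
    obtain ⟨T', hT', hcard, hR', hform⟩ := hR.exists_rearranged hT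
    have hZ : #(conflictVerts Γ E) ≤ paramQ k d :=
      (hR.card_conflictVerts_le hT (by omega) hbig).trans (le_paramQ k d)
    obtain ⟨e, he⟩ : T'.Nonempty := by
      obtain h | h := hR'.mem_ends_or hT' huv
      · obtain ⟨e, he, -⟩ := mem_ends.1 h
        exact ⟨e, he⟩
      · obtain ⟨e, he, -⟩ := mem_ends.1 h
        exact ⟨e, he⟩
    obtain ⟨a, b, rfl, ha, hb⟩ := hform e he
    have hpos (x : V) : 0 < #(conflicts Γ E x) ↔ x ∈ conflictVerts Γ E := by
      simp [conflictVerts, card_pos]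
    refine ⟨a, b, T', hT', hcard, hR', he, exists_isNth_of_card_le ?_
      ⟨(hpos a).2 ha, Or.inr hbig⟩, exists_isNth_of_card_le ?_
      (Or.inr ⟨hbig a, hb.imp (hpos b).2 id⟩)⟩
    · refine le_trans (card_le_card fun x hx => ?_)
        (hZ.trans ((Nat.le_add_right _ _).trans (paramQ_add_le_paramB k d)))
      rw [mem_filter_univ] at hx
      exact (hpos x).1 hx.1
    · refine le_trans (card_le_card (t := conflictVerts Γ E ∪
        ({w | IsRepresentative Γ E w} : Finset V)) fun x hx => ?_) ((card_union_le _ _).trans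
        ((add_le_add hZ ((card_filter_isRepresentative_le Γ E).trans
          (Nat.pow_le_pow_right (by omega) hZ))).trans (paramQ_add_le_paramB k d)))
      rw [mem_filter_univ] at hx
      rw [mem_union, mem_filter_univ]
      rcases hx with hx | hx
      · exact absurd hx.1 (not_le.2 (hbig a))
      · exact hx.2.imp (hpos x).1 id

end Combinatorics

end Dilation

/-! ### Yes-instances and conflicts -/

namespace Dilation

section YesInstance

variable {V : Type*} {Γ G : SimpleGraph V}

theorem walkWeight_nil (u : V) :
    walkWeight Γ (SimpleGraph.Walk.nil : G.Walk u u) = 0 := by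
  simp [walkWeight]

theorem walkWeight_cons {u v w : V} (h : G.Adj u v) (p : G.Walk v w) :
    walkWeight Γ (SimpleGraph.Walk.cons h p) = Γ.edist u v + walkWeight Γ p := by
  simp [walkWeight]

theorem walkWeight_append {u v w : V} (p : G.Walk u v) (q : G.Walk v w) :
    walkWeight Γ (p.append q) = walkWeight Γ p + walkWeight Γ q := by
  simp [walkWeight]

theorem one_le_edist_of_adj {u v : V} (h : G.Adj u v) : 1 ≤ Γ.edist u v :=
  Order.one_le_iff_pos.2 (SimpleGraph.edist_pos_of_ne h.ne)

/-- The dilation is at most two if and only if `G ⊓ Γ` has no conflict. -/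
theorem dilationAtMost_two_iff : DilationAtMost 2 Γ G ↔ ∀ u v, ¬ Conflict Γ (G ⊓ Γ) u v := by
  constructor
  · rintro h u v ⟨huv, h1, h2⟩
    have hle := h u v
    rw [SimpleGraph.edist_eq_one_iff_adj.2 huv, mul_one] at hle
    obtain ⟨p, hp⟩ := iInf_lt_iff.1 (hle.trans_lt (show ((2 : ℕ) : ℕ∞) < 3 by norm_num))
    have hadj : ∀ {a b : V}, Γ.edist a b < 2 → G.Adj a b → Γ.Adj a b := by
      intro a b hab hG
      rw [← SimpleGraph.edist_eq_one_iff_adj]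
      refine le_antisymm ?_ (one_le_edist_of_adj hG)
      exact Order.le_of_lt_add_one (by simpa [one_add_one_eq_two] using hab)
    cases p with
    | nil => exact huv.ne rfl
    | @cons _ w _ e p =>
      have hw1 := one_le_edist_of_adj (Γ := Γ) e
      cases p with
      | nil => exact h1 ⟨e, huv⟩
      | @cons _ x _ e' p =>
        have hw2 := one_le_edist_of_adj (Γ := Γ) e'
        simp only [walkWeight_cons] at hp
        cases p with
        | nil =>
          simp only [walkWeight_nil, add_zero] at hp
          refine h2 w ⟨⟨e, hadj ?_ e⟩, e', hadj ?_ e'⟩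
          · by_contra! hcon
            exact absurd hp (not_lt.2 ((by norm_num : (3 : ℕ∞) ≤ 2 + 1).trans
              (add_le_add hcon hw2)))
          · by_contra! hcon
            exact absurd hp (not_lt.2 ((by norm_num : (3 : ℕ∞) ≤ 1 + 2).trans
              (add_le_add hw1 hcon)))
        | cons e'' p =>
          have hw3 := one_le_edist_of_adj (Γ := Γ) e''
          rw [walkWeight_cons] at hp
          exact absurd hp (not_lt.2 ((by norm_num : (3 : ℕ∞) ≤ 1 + (1 + (1 + 0))).trans
            (add_le_add hw1 (add_le_add hw2 (add_le_add hw3 bot_le)))))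
  · intro h u v
    by_cases htop : Γ.edist u v = ⊤
    · simp [htop]
    obtain ⟨p, hp⟩ := SimpleGraph.exists_walk_of_edist_ne_top htop
    rw [← hp]
    -- replace each step of a shortest path of `Γ` by an edge or by a path with two edges
    have key : ∀ {a b : V} (p : Γ.Walk a b), ∃ q : G.Walk a b,
        walkWeight Γ q ≤ ((2 : ℕ) : ℕ∞) * p.length := by
      intro a b p
      induction p with
      | nil => exact ⟨.nil, by simp [walkWeight_nil]⟩
      | @cons a x b e p ih =>
        obtain ⟨q, hq⟩ := ih
        have hstep : ∃ r : G.Walk a x, walkWeight Γ r ≤ 2 := by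
          have hcov : (G ⊓ Γ).Adj a x ∨ ∃ w, (G ⊓ Γ).Adj a w ∧ (G ⊓ Γ).Adj w x := by
            by_contra! hcon
            exact h a x ⟨e, hcon.1, fun w hw => hcon.2 w hw.1 hw.2⟩
          rcases hcov with h1 | ⟨w, ⟨h1, h2⟩, h3, h4⟩
          · refine ⟨.cons h1.1 .nil, ?_⟩
            rw [walkWeight_cons, walkWeight_nil, SimpleGraph.edist_eq_one_iff_adj.2 e]
            norm_num
          · refine ⟨.cons h1 (.cons h3 .nil), ?_⟩
            rw [walkWeight_cons, walkWeight_cons, walkWeight_nil,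
              SimpleGraph.edist_eq_one_iff_adj.2 h2, SimpleGraph.edist_eq_one_iff_adj.2 h4]
            norm_num
        obtain ⟨r, hr⟩ := hstep
        refine ⟨r.append q, ?_⟩
        rw [walkWeight_append, SimpleGraph.Walk.length_cons]
        refine (add_le_add hr hq).trans (le_of_eq ?_)
        push_cast
        ring
    obtain ⟨q, hq⟩ := key p
    exact (iInf_le _ q).trans hq

/-- New edges outside `Γ` have weight at least two and are of no use. -/
theorem isYesInstance_two_iff {k : ℕ} : IsYesInstance 2 G Γ k ↔
    ∃ T : Finset (Sym2 V), (T : Set (Sym2 V)) ⊆ Γ.edgeSet ∧ T.card ≤ k ∧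
      Resolves Γ (G ⊓ Γ) T := by
  classical
  simp only [IsYesInstance, dilationAtMost_two_iff, Resolves]
  constructor
  · rintro ⟨S, hS, hk, h⟩
    have hT : ((S.filter (· ∈ Γ.edgeSet) : Finset (Sym2 V)) : Set (Sym2 V)) ⊆ Γ.edgeSet :=
      fun e he => (Finset.mem_filter.1 he).2
    refine ⟨S.filter (· ∈ Γ.edgeSet), hT, (Finset.card_filter_le _ _).trans hk, fun u v huv => ?_⟩
    refine h u v (huv.anti ?_)
    intro a b hab
    rw [SimpleGraph.inf_adj, SimpleGraph.sup_adj, SimpleGraph.fromEdgeSet_adj] at hab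
    rw [sup_fromEdgeSet_adj hT]
    refine hab.1.imp (fun h => ⟨h, hab.2⟩) fun h => Finset.mem_filter.2 ⟨h.1, hab.2⟩
  · rintro ⟨T, hT, hk, h⟩
    refine ⟨T.filter (· ∈ Gᶜ.edgeSet), fun e he => (Finset.mem_filter.1 he).2,
      (Finset.card_filter_le _ _).trans hk, fun u v huv => h u v (huv.anti ?_)⟩
    intro a b hab
    rw [sup_fromEdgeSet_adj hT] at hab
    rw [SimpleGraph.inf_adj, SimpleGraph.sup_adj, SimpleGraph.fromEdgeSet_adj]
    rcases hab with hab | hab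
    · exact ⟨Or.inl hab.1, hab.2⟩
    · have hΓ : Γ.Adj a b := hT hab
      by_cases hG : G.Adj a b
      · exact ⟨Or.inl hG, hΓ⟩
      · exact ⟨Or.inr ⟨Finset.mem_filter.2 ⟨hab, by simp [hG, hΓ.ne]⟩, hΓ.ne⟩, hΓ⟩

end YesInstance

/-! ### The search for a solution -/

section Search

open Finset
open scoped Classical

variable {V : Type*} [Fintype V] [LinearOrder V]

/-- The edge of `Γ` from candidate number `c` for the first end to candidate number `c'` for the
second end, or nothing if there are not so many candidates. -/
noncomputable def chosenEdge (k M : ℕ) (G Γ E : SimpleGraph V) (c c' : ℕ) : Finset (Sym2 V) :=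
  {e | ∃ a b, e = s(a, b) ∧ Γ.Adj a b ∧ IsNth (IsFirstEnd M Γ E) c a ∧
    IsNth (IsSecondEnd k M G Γ E a) c' b}

/-- One round of the search: the current graph is extended by the edge that the two lowest digits
in base `B` of the second component choose, and these two digits are dropped. -/
noncomputable def searchStep (k M B : ℕ) (G Γ : SimpleGraph V) (p : SimpleGraph V × ℕ) :
    SimpleGraph V × ℕ :=
  (p.1 ⊔ SimpleGraph.fromEdgeSet (chosenEdge k M G Γ p.1 (p.2 % B) (p.2 / B % B) : Set (Sym2 V)),
    p.2 / B / B)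

variable {k M B d : ℕ} {G Γ : SimpleGraph V}

theorem chosenEdge_subset (E : SimpleGraph V) (c c' : ℕ) :
    (chosenEdge k M G Γ E c c' : Set (Sym2 V)) ⊆ Γ.edgeSet := by
  intro e he
  obtain ⟨a, b, rfl, hab, -⟩ := (mem_filter.1 he).2
  exact hab

theorem chosenEdge_eq {E : SimpleGraph V} {c c' : ℕ} {a b : V} (hab : Γ.Adj a b)
    (ha : IsNth (IsFirstEnd M Γ E) c a) (hb : IsNth (IsSecondEnd k M G Γ E a) c' b) :
    chosenEdge k M G Γ E c c' = {s(a, b)} := by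
  ext e
  rw [chosenEdge, mem_filter_univ, mem_singleton]
  constructor
  · rintro ⟨x, y, rfl, -, hx, hy⟩
    obtain rfl := hx.unique ha
    rw [hy.unique hb]
  · rintro rfl
    exact ⟨a, b, rfl, hab, ha, hb⟩

theorem chosenEdge_eq_empty {E : SimpleGraph V} {c c' : ℕ}
    (h : ∀ a b, Γ.Adj a b → IsNth (IsFirstEnd M Γ E) c a →
      ¬ IsNth (IsSecondEnd k M G Γ E a) c' b) : chosenEdge k M G Γ E c c' = ∅ := by
  rw [chosenEdge, filter_eq_empty_iff]
  rintro e - ⟨a, b, -, hab, ha, hb⟩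
  exact h a b hab ha hb

theorem card_chosenEdge_le (E : SimpleGraph V) (c c' : ℕ) :
    #(chosenEdge k M G Γ E c c') ≤ 1 := by
  rcases (chosenEdge k M G Γ E c c').eq_empty_or_nonempty with h | ⟨e, he⟩
  · simp [h]
  · obtain ⟨a, b, rfl, hab, ha, hb⟩ := (mem_filter.1 he).2
    simp [chosenEdge_eq hab ha hb]

/-- Soundness of the search: in `i` rounds it adds at most `i` edges of `Γ`. -/
theorem exists_iterate_searchStep_eq (E : SimpleGraph V) (h i : ℕ) :
    ∃ S : Finset (Sym2 V), (S : Set (Sym2 V)) ⊆ Γ.edgeSet ∧ #S ≤ i ∧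
      ((searchStep k M B G Γ)^[i] (E, h)).1 = E ⊔ SimpleGraph.fromEdgeSet (S : Set (Sym2 V)) := by
  induction i with
  | zero => exact ⟨∅, by simp, by simp, by simp⟩
  | succ i ih =>
    obtain ⟨S, hS, hi, hE⟩ := ih
    set p := (searchStep k M B G Γ)^[i] (E, h) with hp
    refine ⟨S ∪ chosenEdge k M G Γ p.1 (p.2 % B) (p.2 / B % B), ?_,
      (card_union_le _ _).trans (add_le_add hi (card_chosenEdge_le _ _ _)), ?_⟩
    · rw [coe_union]
      exact Set.union_subset hS (chosenEdge_subset _ _ _)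
    · rw [Function.iterate_succ_apply', ← hp, coe_union, SimpleGraph.fromEdgeSet_union,
        ← sup_assoc, ← hE, searchStep]

theorem le_iterate_searchStep (E : SimpleGraph V) (h i : ℕ) :
    E ≤ ((searchStep k M B G Γ)^[i] (E, h)).1 := by
  obtain ⟨S, -, -, hS⟩ := exists_iterate_searchStep_eq (k := k) (M := M) (B := B) (G := G) (Γ := Γ)
    E h i
  exact hS ▸ le_sup_left

/-- If some set of new edges resolves all conflicts, then some choices of candidates lead there. -/
theorem Resolves.exists_search (hG : BicliqueFree d G) (j : ℕ) {E : SimpleGraph V}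
    {S T : Finset (Sym2 V)}
    (hE : E = (G ⊓ Γ) ⊔ SimpleGraph.fromEdgeSet (S : Set (Sym2 V)))
    (hS : (S : Set (Sym2 V)) ⊆ Γ.edgeSet) (hT : (T : Set (Sym2 V)) ⊆ Γ.edgeSet)
    (hk : #S + #T ≤ k) (hj : #T ≤ j) (hR : Resolves Γ E T) :
    ∃ h < (paramB k d * paramB k d) ^ j, ∀ u v, ¬ Conflict Γ
      ((searchStep k (paramM k d) (paramB k d) G Γ)^[j] (E, h)).1 u v := by
  set B := paramB k d with hB
  have hBpos : 0 < B := by simp [hB, paramB]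
  induction j generalizing E S T with
  | zero =>
    obtain rfl : T = ∅ := card_eq_zero.1 (by omega)
    exact ⟨0, by simp, by simpa [Resolves] using hR⟩
  | succ j ih =>
    by_cases hcon : ∃ u v, Conflict Γ E u v
    · obtain ⟨u, v, huv⟩ := hcon
      obtain ⟨a, b, T', hT', hcard, hR', habT, ⟨c, hc, ha⟩, c', hc', hb⟩ :=
        hR.exists_candidate hG hE hS hT hk huv
      have hab : Γ.Adj a b := hT' habT
      have hTe : #(T'.erase s(a, b)) + 1 = #T' := card_erase_add_one habT
      have hSi := card_insert_le s(a, b) S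
      have hE' : E ⊔ SimpleGraph.fromEdgeSet (({s(a, b)} : Finset (Sym2 V)) : Set (Sym2 V)) =
          (G ⊓ Γ) ⊔ SimpleGraph.fromEdgeSet ((insert s(a, b) S : Finset (Sym2 V)) :
            Set (Sym2 V)) := by
        rw [hE, sup_assoc, ← SimpleGraph.fromEdgeSet_union, ← coe_union, union_comm]
        rfl
      have hS' : ((insert s(a, b) S : Finset (Sym2 V)) : Set (Sym2 V)) ⊆ Γ.edgeSet := by
        rw [coe_insert]
        exact Set.insert_subset hab hS
      have hTe' : ((T'.erase s(a, b) : Finset (Sym2 V)) : Set (Sym2 V)) ⊆ Γ.edgeSet := by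
        rw [coe_erase]
        exact Set.sdiff_subset.trans hT'
      have hRe : Resolves Γ (E ⊔ SimpleGraph.fromEdgeSet
          (({s(a, b)} : Finset (Sym2 V)) : Set (Sym2 V))) (T'.erase s(a, b)) := by
        rw [Resolves, sup_assoc, ← SimpleGraph.fromEdgeSet_union, ← coe_union]
        have : {s(a, b)} ∪ T'.erase s(a, b) = T' := insert_erase habT
        rw [this]
        exact hR'
      obtain ⟨h, hh, hsol⟩ := ih hE' hS' hTe' (by omega) (by omega) hRe
      -- `c` and `c'` are the two lowest digits, the choices for the remaining rounds follow
      refine ⟨c + B * (c' + B * h), ?_, ?_⟩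
      · have h1 : c' + B * h + 1 ≤ B * (B * B) ^ j := by
          have : B * (h + 1) ≤ B * (B * B) ^ j := Nat.mul_le_mul_left _ hh
          rw [mul_add] at this
          omega
        have h2 : B * (c' + B * h + 1) ≤ B * (B * (B * B) ^ j) := Nat.mul_le_mul_left _ h1
        rw [mul_add] at h2
        rw [pow_succ']
        calc c + B * (c' + B * h) < B * (c' + B * h) + B * 1 := by omega
          _ ≤ _ := h2
          _ = _ := by ring
      · have e1 : (c + B * (c' + B * h)) % B = c := by
          rw [Nat.add_mul_mod_self_left, Nat.mod_eq_of_lt hc]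
        have e2 : (c + B * (c' + B * h)) / B = c' + B * h := by
          rw [Nat.add_mul_div_left _ _ hBpos, Nat.div_eq_of_lt hc, zero_add]
        have e3 : (c' + B * h) % B = c' := by
          rw [Nat.add_mul_mod_self_left, Nat.mod_eq_of_lt hc']
        have e4 : (c' + B * h) / B = h := by
          rw [Nat.add_mul_div_left _ _ hBpos, Nat.div_eq_of_lt hc', zero_add]
        rw [Function.iterate_succ_apply, searchStep]
        simp only [e1, e2, e3, e4]
        rw [chosenEdge_eq hab ha hb]
        exact hsol
    · push Not at hcon
      exact ⟨0, by positivity, fun u v huv => hcon u v (huv.anti (le_iterate_searchStep _ _ _))⟩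

/-- A bound on the number of sequences of choices. -/
def paramF (k d : ℕ) : ℕ := 2 ^ paramB k d

theorem paramB_mul_self_pow_le (k d : ℕ) : (paramB k d * paramB k d) ^ k ≤ paramF k d := by
  rw [paramF, paramB, ← pow_add, ← pow_mul]
  refine Nat.pow_le_pow_right (by omega) ?_
  set Q := paramQ k d with hQ
  have h1 : 4 * k ≤ Q := by
    have h2 := four_mul_le_paramM k d
    have h3 := paramM_mul_self k d
    nlinarith
  have h2 : Q < 2 ^ Q := Nat.lt_two_pow_self
  have h3 : 2 ^ (4 * Q) = 2 ^ Q * 2 ^ Q * (2 ^ Q * 2 ^ Q) := by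
    rw [← pow_add, ← pow_add]
    congr 1
    omega
  rw [h3]
  calc (4 * Q + 4 * Q) * k = 2 * Q * (4 * k) := by ring
    _ ≤ 2 * Q * Q := Nat.mul_le_mul_left _ h1
    _ ≤ 2 ^ Q * 2 ^ Q * (2 ^ Q * 2 ^ Q) := by
      rcases Nat.eq_zero_or_pos Q with h0 | h0
      · simp [h0]
      · have h5 : 2 ≤ 2 ^ Q := by omega
        have h6 : 2 * Q * Q ≤ 2 ^ Q * 2 ^ Q * 2 ^ Q :=
          Nat.mul_le_mul (Nat.mul_le_mul h5 h2.le) h2.le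
        nlinarith

/-- The instance is a yes-instance if and only if one of the sequences of choices, encoded by a
number below `paramF k d`, resolves all conflicts. -/
theorem isYesInstance_two_iff_exists_search (hG : BicliqueFree d G) : IsYesInstance 2 G Γ k ↔
    ∃ h < paramF k d, ∀ u v, ¬ Conflict Γ
      ((searchStep k (paramM k d) (paramB k d) G Γ)^[k] (G ⊓ Γ, h)).1 u v := by
  rw [isYesInstance_two_iff]
  constructor
  · rintro ⟨T, hT, hk, hR⟩
    obtain ⟨h, hh, hsol⟩ := hR.exists_search hG k (S := ∅) (by simp) (by simp) hT (by simpa) hk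
    exact ⟨h, hh.trans_le (paramB_mul_self_pow_le k d), hsol⟩
  · rintro ⟨h, -, hsol⟩
    obtain ⟨S, hS, hk, hE⟩ := exists_iterate_searchStep_eq (k := k) (M := paramM k d)
      (B := paramB k d) (G := G) (Γ := Γ) (G ⊓ Γ) h k
    rw [hE] at hsol
    exact ⟨S, hS, hk, hsol⟩

end Search

end Dilation

/-! ### Logical connectives as expressions -/

namespace RAM.Expression

/-- An expression, regarded as a formula, holds if its value is not zero. -/
def Holds (e : Expression) (σ : State) : Prop := e.eval σ ≠ 0

/-- negation -/
def not (e : Expression) : Expression := .sub (.num 1) e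

/-- conjunction -/
def and (a b : Expression) : Expression := not (.add (not a) (not b))

/-- disjunction -/
def or (a b : Expression) : Expression := .add a b

/-- The first value is smaller than the second one. -/
def lt (a b : Expression) : Expression := .sub b a

/-- The first value is not larger than the second one. -/
def le (a b : Expression) : Expression := not (.sub a b)

/-- The formula `e` holds for some `x` below the content of register `r`. -/
def any (x r : ℕ) (e : Expression) : Expression := .sum x r e

/-- The number of all `x` below the content of register `r` for which the formula `e` holds. -/
def count (x r : ℕ) (e : Expression) : Expression := .sum x r (not (not e))

variable {σ : State} {a b e : Expression} {x r n : ℕ}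

theorem holds_not : (not e).Holds σ ↔ ¬ e.Holds σ := by
  simp only [Holds, not, eval]
  omega

theorem holds_and : (and a b).Holds σ ↔ a.Holds σ ∧ b.Holds σ := by
  simp only [Holds, and, not, eval]
  omega

theorem holds_or : (or a b).Holds σ ↔ a.Holds σ ∨ b.Holds σ := by
  simp only [Holds, or, eval]
  omega

theorem holds_lt : (lt a b).Holds σ ↔ a.eval σ < b.eval σ := by
  simp only [Holds, lt, eval]
  omega

theorem holds_le : (le a b).Holds σ ↔ a.eval σ ≤ b.eval σ := by
  simp only [Holds, le, not, eval]
  omega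

theorem holds_any {p : Fin n → Prop} (hr : σ.reg r = n)
    (h : ∀ i : Fin n, e.Holds (σ.setReg x i) ↔ p i) : (any x r e).Holds σ ↔ ∃ i, p i := by
  simp only [Holds, any, eval, hr, Finset.sum_range, ne_eq, Finset.sum_eq_zero_iff,
    Finset.mem_univ, true_imp_iff, not_forall]
  exact exists_congr h

theorem eval_count {p : Fin n → Prop} [DecidablePred p] (hr : σ.reg r = n)
    (h : ∀ i : Fin n, e.Holds (σ.setReg x i) ↔ p i) :
    (count x r e).eval σ = Finset.card {i | p i} := by
  simp only [count, eval, hr, Finset.sum_range, Finset.card_filter]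
  refine Finset.sum_congr rfl fun i _ => ?_
  have := h i
  simp only [Holds] at this
  simp only [not, eval]
  split_ifs with hp
  · have := this.2 hp
    omega
  · have := mt this.1 hp
    omega

/-- The expression for the `c`-th number `x` with property `e`, counting from zero, where `c` is a
register: it is the number of all `y` such that at most `c` numbers `x ≤ y` have the property. -/
def nth (y x r : ℕ) (e : Expression) (c : ℕ) : Expression :=
  count y r (le (count x r (and (le (.var x) (.var y)) e)) (.var c))

open scoped Classical in
/-- The numbers `i` such that at most `c` numbers `v ≤ i` satisfy `p` form an initial segment, which
ends right before the `c`-th number that satisfies `p`. -/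
theorem card_filter_eq_iff_isNth (p : Fin n → Prop) (c : ℕ) (u : Fin n) :
    Finset.card {i : Fin n | Finset.card {v : Fin n | v ≤ i ∧ p v} ≤ c} = u ↔
      Dilation.IsNth p c u := by
  set D : Finset (Fin n) := {i | Finset.card {v : Fin n | v ≤ i ∧ p v} ≤ c} with hD
  have hmem (i : Fin n) : i ∈ D ↔ Finset.card {v : Fin n | v ≤ i ∧ p v} ≤ c := by simp [hD]
  have hdown {i j : Fin n} (hij : i ≤ j) (hj : j ∈ D) : i ∈ D := by
    rw [hmem] at hj ⊢
    refine (Finset.card_le_card fun v hv => ?_).trans hj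
    rw [Finset.mem_filter_univ] at hv ⊢
    exact ⟨hv.1.trans hij, hv.2⟩
  have hsplit : (p u → Finset.card {v : Fin n | v ≤ u ∧ p v} =
      Finset.card {v : Fin n | v < u ∧ p v} + 1) ∧
      (¬ p u → Finset.card {v : Fin n | v ≤ u ∧ p v} =
        Finset.card {v : Fin n | v < u ∧ p v}) := by
    constructor
    · intro hu
      rw [← Finset.card_insert_of_notMem (a := u) (by simp)]
      congr 1
      ext v
      simp only [Finset.mem_filter_univ, Finset.mem_insert, le_iff_lt_or_eq]
      constructor
      · rintro ⟨h | h, hp⟩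
        · exact Or.inr ⟨h, hp⟩
        · exact Or.inl h
      · rintro (rfl | h)
        · exact ⟨Or.inr rfl, hu⟩
        · exact ⟨Or.inl h.1, h.2⟩
    · intro hu
      congr 1
      ext v
      simp only [Finset.mem_filter_univ, le_iff_lt_or_eq]
      constructor
      · rintro ⟨h | h, hp⟩
        · exact ⟨h, hp⟩
        · exact absurd (h ▸ hp) hu
      · exact fun h => ⟨Or.inl h.1, h.2⟩
  constructor
  · intro h
    have hu : u ∉ D := by
      intro hu
      have : (Finset.Iic u).card ≤ D.card :=
        Finset.card_le_card fun i hi => hdown (Finset.mem_Iic.1 hi) hu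
      rw [Fin.card_Iic] at this
      omega
    have hlt : ∀ i < u, i ∈ D := by
      intro i hi
      by_contra hiD
      have : D.card ≤ (Finset.Iio i).card := Finset.card_le_card fun j hj => by
        rw [Finset.mem_Iio]
        by_contra hij
        exact hiD (hdown (not_lt.1 hij) hj)
      rw [Fin.card_Iio] at this
      have : (i : ℕ) < u := hi
      omega
    have hle : Finset.card {v : Fin n | v < u ∧ p v} ≤ c := by
      rcases Nat.eq_zero_or_pos (u : ℕ) with h0 | h0
      · rw [Finset.card_eq_zero.2]
        · omega
        · rw [Finset.filter_eq_empty_iff]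
          rintro v - ⟨hv, -⟩
          have : (v : ℕ) < u := hv
          omega
      · have hw := (hmem ⟨u - 1, by omega⟩).1 (hlt _ (by
          change (u : ℕ) - 1 < u
          omega))
        refine (Finset.card_le_card fun v hv => ?_).trans hw
        rw [Finset.mem_filter_univ] at hv ⊢
        have : (v : ℕ) < u := hv.1
        exact ⟨by change (v : ℕ) ≤ u - 1; omega, hv.2⟩
    rw [hmem] at hu
    by_cases hp : p u
    · exact ⟨hp, by have := hsplit.1 hp; omega⟩
    · have := hsplit.2 hp
      omega
  · rintro ⟨hp, hc⟩
    have : D = Finset.Iio u := by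
      ext i
      rw [hmem, Finset.mem_Iio]
      constructor
      · intro hi
        by_contra hiu
        have h1 : u ∈ D := hdown (not_lt.1 hiu) ((hmem i).2 hi)
        rw [hmem, hsplit.1 hp] at h1
        omega
      · intro hi
        rw [← hc]
        refine Finset.card_le_card fun v hv => ?_
        rw [Finset.mem_filter_univ] at hv ⊢
        exact ⟨hv.1.trans_lt hi, hv.2⟩
    rw [this, Fin.card_Iio]

theorem eval_nth {p : Fin n → Prop} {x y c : ℕ} (hr : σ.reg r = n) (hxy : x ≠ y) (hry : r ≠ y)
    (hcx : c ≠ y)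
    (h : ∀ i j : Fin n, e.Holds ((σ.setReg y j).setReg x i) ↔ p i) (u : Fin n) :
    (nth y x r e c).eval σ = u ↔ Dilation.IsNth p (σ.reg c) u := by
  classical
  rw [← card_filter_eq_iff_isNth, nth, eval_count
    (p := fun j : Fin n => Finset.card {i : Fin n | i ≤ j ∧ p i} ≤ σ.reg c) hr fun j => ?_]
  rw [holds_le, eval_count (p := fun i : Fin n => i ≤ j ∧ p i) (by simpa [hry] using hr)
    fun i => ?_]
  · simp only [eval, State.setReg_reg, hcx, if_false]
  · rw [holds_and, holds_le, h]
    simp [eval, hxy.symm]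

end RAM.Expression

/-! ### Formulas for the candidates

The registers `0`, `1`, `2` hold the input numbers `n`, `k`, `d`, the registers `3`, `5`, `7` hold the
parameters `paramF k d`, `paramB k d`, `paramM k d`, and the arrays `0`, `1`, `2` hold the adjacency
matrices of `G`, of `Γ` and of the current graph `E`. The registers from `20` to `43`, `57` and
`58` serve as bound variables. A formula with a larger bound variable may contain those with smaller ones, hence
the lower bounds on the names of the free variables in the lemmas below.
-/

namespace Dilation

open RAM

/-- The cell of an adjacency matrix for the pair of vertices in the registers `x` and `y`. The
multiplication by `n` is a sum with `n` summands, each of which counts the numbers below the content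
of `x`. -/
def cellExpr (x y : ℕ) : Expression :=
  .add (.sum 21 0 (.count 20 0 (.lt (.var 20) (.var x)))) (.var y)

/-- The entry of the adjacency matrix in array `A` for the vertices in the registers `x`, `y`. -/
def adjExpr (A x y : ℕ) : Expression := .get A (cellExpr x y)

/-- The formula for `Conflict`. -/
def conflictExpr (x y : ℕ) : Expression :=
  .and (adjExpr 1 x y) (.and (.not (adjExpr 2 x y))
    (.not (.any 22 0 (.and (adjExpr 2 x 22) (adjExpr 2 22 y)))))

/-- The expression for the number of conflicts of a vertex. -/
def degExpr (x : ℕ) : Expression := .count 23 0 (conflictExpr x 23)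

/-- The formula for `IsFirstEnd`. -/
def firstEndExpr (x : ℕ) : Expression :=
  .and (degExpr x) (.or (.le (.var 7) (degExpr x)) (.not (.any 24 0 (.le (.var 7) (degExpr 24)))))

/-- The formula saying that the vertex in `w` has many neighbours among those that form a conflict
with the vertex in `x`. -/
def heavyExpr (x w : ℕ) : Expression :=
  .le (degExpr x) (.add (.sum 25 1 (.count 26 0 (.and (conflictExpr x 26) (adjExpr 0 w 26))))
    (.add (.var 1) (.var 1)))

/-- The formula saying that exactly one of the entries for `x`, `y` and for `x`, `z` is zero. -/
def differExpr (A x y z : ℕ) : Expression :=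
  .or (.and (adjExpr A x y) (.not (adjExpr A x z))) (.and (.not (adjExpr A x y)) (adjExpr A x z))

/-- The formula for `IsRepresentative`. -/
def representativeExpr (w : ℕ) : Expression :=
  .not (.any 27 0 (.and (.lt (.var 27) (.var w))
    (.not (.any 28 0 (.and (degExpr 28) (.or (differExpr 1 28 w 27) (differExpr 2 28 w 27)))))))

/-- The formula for `IsSecondEnd`. -/
def secondEndExpr (x w : ℕ) : Expression :=
  .or (.and (.le (.var 7) (degExpr x)) (heavyExpr x w))
    (.and (.lt (degExpr x) (.var 7)) (.or (degExpr w) (representativeExpr w)))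

/-- The formula saying that there is a conflict. -/
def someConflictExpr : Expression := .any 57 0 (.any 58 0 (conflictExpr 57 58))

/-- The state holds the input and the parameters. -/
structure HoldsInput {n : ℕ} (k d : ℕ) (G Γ : SimpleGraph (Fin n)) (σ : State) : Prop where
  reg_zero : σ.reg 0 = n
  reg_one : σ.reg 1 = k
  reg_three : σ.reg 3 = paramF k d
  reg_five : σ.reg 5 = paramB k d
  reg_seven : σ.reg 7 = paramM k d
  arr_zero : ∀ u v : Fin n, σ.arr 0 (u * n + v) ≠ 0 ↔ G.Adj u v
  arr_one : ∀ u v : Fin n, σ.arr 1 (u * n + v) ≠ 0 ↔ Γ.Adj u v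

/-- The state holds the input and the parameters, and array `2` is an adjacency matrix of the
current graph `E`. -/
structure Represents {n : ℕ} (k d : ℕ) (G Γ E : SimpleGraph (Fin n)) (σ : State) : Prop
    extends HoldsInput k d G Γ σ where
  arr_two : ∀ u v : Fin n, σ.arr 2 (u * n + v) ≠ 0 ↔ E.Adj u v

section

open RAM.Expression

variable {n k d : ℕ} {G Γ E : SimpleGraph (Fin n)} {σ : State}

theorem HoldsInput.setReg (h : HoldsInput k d G Γ σ) {x a : ℕ} (hx : x = 6 ∨ 7 < x) :
    HoldsInput k d G Γ (σ.setReg x a) := by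
  have h0 : (0 : ℕ) ≠ x := by omega
  have h1 : (1 : ℕ) ≠ x := by omega
  have h3 : (3 : ℕ) ≠ x := by omega
  have h5 : (5 : ℕ) ≠ x := by omega
  have h7 : (7 : ℕ) ≠ x := by omega
  constructor
  · simpa [h0] using h.reg_zero
  · simpa [h1] using h.reg_one
  · simpa [h3] using h.reg_three
  · simpa [h5] using h.reg_five
  · simpa [h7] using h.reg_seven
  · exact h.arr_zero
  · exact h.arr_one

theorem Represents.setReg (h : Represents k d G Γ E σ) {x a : ℕ} (hx : x = 6 ∨ 7 < x) :
    Represents k d G Γ E (σ.setReg x a) :=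
  ⟨h.toHoldsInput.setReg hx, h.arr_two⟩

theorem cell_inj {n : ℕ} {u v u' v' : Fin n} (h : (u : ℕ) * n + v = u' * n + v') :
    u = u' ∧ v = v' := by
  have hn : 0 < n := u.pos
  have h1 := congrArg (· / n) h
  have h2 := congrArg (· % n) h
  simp only [mul_comm _ n, Nat.mul_add_div hn, Nat.div_eq_of_lt v.2, Nat.div_eq_of_lt v'.2,
    Nat.mul_add_mod, Nat.mod_eq_of_lt v.2, Nat.mod_eq_of_lt v'.2, add_zero] at h1 h2
  exact ⟨Fin.ext h1, Fin.ext h2⟩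

theorem eval_cellExpr (h0 : σ.reg 0 = n) {x y : ℕ} (hx : 21 < x) {u : Fin n} (hu : σ.reg x = u) :
    (cellExpr x y).eval σ = u * n + σ.reg y := by
  have hx0 : x ≠ 20 := by omega
  have hx1 : x ≠ 21 := by omega
  have key (i : ℕ) : (count 20 0 (.lt (.var 20) (.var x))).eval (σ.setReg 21 i) = u := by
    rw [eval_count (n := n) (p := fun j => j < u) (by simpa using h0) fun j => ?_]
    · have := Fin.card_Iio u
      rwa [← Finset.filter_gt_eq_Iio] at this
    · rw [holds_lt]
      simp [eval, hx0, hx1, hu]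
  simp [cellExpr, eval, key, h0, mul_comm]

theorem holds_adjExpr (h0 : σ.reg 0 = n) {A x y : ℕ} (hx : 21 < x) {u : Fin n}
    (hu : σ.reg x = u) : (adjExpr A x y).Holds σ ↔ σ.arr A (u * n + σ.reg y) ≠ 0 := by
  rw [Holds, adjExpr, eval, eval_cellExpr h0 hx hu]

theorem HoldsInput.holds_adjExpr_zero (h : HoldsInput k d G Γ σ) {x y : ℕ} (hx : 21 < x)
    {u v : Fin n} (hu : σ.reg x = u) (hv : σ.reg y = v) :
    (adjExpr 0 x y).Holds σ ↔ G.Adj u v := by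
  rw [holds_adjExpr h.reg_zero hx hu, hv, h.arr_zero]

theorem HoldsInput.holds_adjExpr_one (h : HoldsInput k d G Γ σ) {x y : ℕ} (hx : 21 < x)
    {u v : Fin n} (hu : σ.reg x = u) (hv : σ.reg y = v) :
    (adjExpr 1 x y).Holds σ ↔ Γ.Adj u v := by
  rw [holds_adjExpr h.reg_zero hx hu, hv, h.arr_one]

theorem Represents.holds_adjExpr_two (h : Represents k d G Γ E σ) {x y : ℕ} (hx : 21 < x)
    {u v : Fin n} (hu : σ.reg x = u) (hv : σ.reg y = v) :
    (adjExpr 2 x y).Holds σ ↔ E.Adj u v := by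
  rw [holds_adjExpr h.reg_zero hx hu, hv, h.arr_two]

theorem Represents.holds_conflictExpr (h : Represents k d G Γ E σ) {x y : ℕ} (hx : 22 < x)
    (hy : 22 < y) {u v : Fin n} (hu : σ.reg x = u) (hv : σ.reg y = v) :
    (conflictExpr x y).Holds σ ↔ Conflict Γ E u v := by
  have hx' : x ≠ 22 := by omega
  have hy' : y ≠ 22 := by omega
  rw [conflictExpr, holds_and, holds_and, holds_not, holds_not,
    h.holds_adjExpr_one (by omega) hu hv, h.holds_adjExpr_two (by omega) hu hv,
    holds_any (p := fun w => E.Adj u w ∧ E.Adj w v) h.reg_zero fun w => ?_, not_exists, Conflict]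
  have h' := h.setReg (x := 22) (a := w) (by omega)
  rw [holds_and, h'.holds_adjExpr_two (u := u) (v := w) (by omega) (by simp [hx', hu]) (by simp),
    h'.holds_adjExpr_two (u := w) (v := v) (by omega) (by simp) (by simp [hy', hv])]

open scoped Classical in
theorem Represents.eval_degExpr (h : Represents k d G Γ E σ) {x : ℕ} (hx : 23 < x) {u : Fin n}
    (hu : σ.reg x = u) : (degExpr x).eval σ = (conflicts Γ E u).card := by
  have hx' : x ≠ 23 := by omega
  exact eval_count h.reg_zero fun v => (h.setReg (x := 23) (a := v) (by omega)).holds_conflictExpr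
    (by omega) (by omega) (by simp [hx', hu]) (by simp)

theorem Represents.holds_firstEndExpr (h : Represents k d G Γ E σ) {x : ℕ} (hx : 24 < x)
    {u : Fin n} (hu : σ.reg x = u) :
    (firstEndExpr x).Holds σ ↔ IsFirstEnd (paramM k d) Γ E u := by
  rw [firstEndExpr, holds_and, holds_or, holds_le, holds_not, Holds,
    h.eval_degExpr (by omega) hu,
    holds_any (p := fun v => paramM k d ≤ (conflicts Γ E v).card) h.reg_zero fun v => ?_]
  · simp only [eval, h.reg_seven, IsFirstEnd, not_exists, not_le, Nat.pos_iff_ne_zero]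
  · have h' := h.setReg (x := 24) (a := v) (by omega)
    rw [holds_le, h'.eval_degExpr (u := v) (by omega) (by simp), eval, h'.reg_seven]

open scoped Classical in
theorem Represents.holds_heavyExpr (h : Represents k d G Γ E σ) {x w : ℕ} (hx : 26 < x)
    (hw : 26 < w) {a b : Fin n} (ha : σ.reg x = a) (hb : σ.reg w = b) :
    (heavyExpr x w).Holds σ ↔ (conflicts Γ E a).card ≤
      k * Finset.card {v ∈ conflicts Γ E a | G.Adj b v} + 2 * k := by
  have hx5 : x ≠ 25 := by omega
  have hx6 : x ≠ 26 := by omega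
  have hw5 : w ≠ 25 := by omega
  have hw6 : w ≠ 26 := by omega
  have key (i : ℕ) : (count 26 0 (.and (conflictExpr x 26) (adjExpr 0 w 26))).eval
      (σ.setReg 25 i) = Finset.card {v ∈ conflicts Γ E a | G.Adj b v} := by
    have h' := h.setReg (x := 25) (a := i) (by omega)
    rw [eval_count (p := fun v => Conflict Γ E a v ∧ G.Adj b v) h'.reg_zero fun v => ?_]
    · rw [conflicts, Finset.filter_filter]
    · have h'' := h'.setReg (x := 26) (a := v) (by omega)
      rw [holds_and, h''.holds_conflictExpr (u := a) (v := v) (by omega) (by omega)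
        (by simp [hx5, hx6, ha]) (by simp),
        h''.holds_adjExpr_zero (u := b) (v := v) (by omega) (by simp [hw5, hw6, hb]) (by simp)]
  rw [heavyExpr, holds_le, h.eval_degExpr (by omega) ha]
  simp only [eval, key, h.reg_one, Finset.sum_const, Finset.card_range, smul_eq_mul, two_mul]

theorem holds_differExpr {A x y z : ℕ} {p q : Prop} (hp : (adjExpr A x y).Holds σ ↔ p)
    (hq : (adjExpr A x z).Holds σ ↔ q) : (differExpr A x y z).Holds σ ↔ ¬ (p ↔ q) := by
  rw [differExpr, holds_or, holds_and, holds_and, holds_not, holds_not, hp, hq]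
  tauto

theorem Represents.holds_representativeExpr (h : Represents k d G Γ E σ) {w : ℕ} (hw : 28 < w)
    {b : Fin n} (hb : σ.reg w = b) :
    (representativeExpr w).Holds σ ↔ IsRepresentative Γ E b := by
  have hw7 : w ≠ 27 := by omega
  have hw8 : w ≠ 28 := by omega
  rw [representativeExpr, holds_not,
    holds_any (p := fun b' => b' < b ∧ SameType Γ E b b') h.reg_zero fun b' => ?_]
  · simp only [IsRepresentative, not_exists, not_and]
  have h' := h.setReg (x := 27) (a := b') (by omega)
  rw [holds_and, holds_not, holds_lt, holds_any (p := fun z => z ∈ conflictVerts Γ E ∧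
    (¬ (Γ.Adj z b ↔ Γ.Adj z b') ∨ ¬ (E.Adj z b ↔ E.Adj z b'))) h'.reg_zero fun z => ?_]
  · refine and_congr ?_ ?_
    · simp [eval, hw7, hb]
    · simp only [SameType, not_exists, not_and, not_or, not_not]
  · have h'' := h'.setReg (x := 28) (a := z) (by omega)
    have hz : ((σ.setReg 27 b').setReg 28 z).reg 28 = z := by simp
    have hb1 : ((σ.setReg 27 b').setReg 28 z).reg w = b := by simp [hw7, hw8, hb]
    have hb2 : ((σ.setReg 27 b').setReg 28 z).reg 27 = b' := by simp
    rw [holds_and, holds_or, Holds, h''.eval_degExpr (u := z) (by omega) hz,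
      holds_differExpr (h''.holds_adjExpr_one (by omega) hz hb1)
        (h''.holds_adjExpr_one (by omega) hz hb2),
      holds_differExpr (h''.holds_adjExpr_two (by omega) hz hb1)
        (h''.holds_adjExpr_two (by omega) hz hb2)]
    simp [conflictVerts, Finset.nonempty_iff_ne_empty]

theorem Represents.holds_secondEndExpr (h : Represents k d G Γ E σ) {x w : ℕ} (hx : 28 < x)
    (hw : 28 < w) {a b : Fin n} (ha : σ.reg x = a) (hb : σ.reg w = b) :
    (secondEndExpr x w).Holds σ ↔ IsSecondEnd k (paramM k d) G Γ E a b := by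
  rw [secondEndExpr, holds_or, holds_and, holds_and, holds_or, holds_le, holds_lt,
    h.holds_heavyExpr (by omega) (by omega) ha hb, h.holds_representativeExpr hw hb, Holds,
    h.eval_degExpr (by omega) ha, h.eval_degExpr (by omega) hb]
  simp only [eval, h.reg_seven, IsSecondEnd, Nat.pos_iff_ne_zero]

theorem Represents.holds_someConflictExpr (h : Represents k d G Γ E σ) :
    someConflictExpr.Holds σ ↔ ∃ u v, Conflict Γ E u v := by
  refine holds_any h.reg_zero fun u => ?_
  have h' := h.setReg (x := 57) (a := u) (by omega)
  refine holds_any h'.reg_zero fun v => ?_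
  exact (h'.setReg (x := 58) (a := v) (by omega)).holds_conflictExpr (by omega) (by omega)
    (by simp) (by simp)

end

end Dilation

/-! ### The search as a command -/

namespace Dilation

open RAM

/-- The expression for the product of the base, held in register `5`, with the content of
register `r`. -/
def timesBaseExpr (r : ℕ) : Expression :=
  .sum 41 5 (.count 40 3 (.lt (.var 40) (.var r)))

/-- The expression for the quotient of the content of register `6` by the base: the number of all `i`
such that `i + 1` times the base is not larger than the content. -/
def quotientExpr : Expression :=
  .count 43 3 (.le (.add (timesBaseExpr 43) (.var 5)) (.var 6))

/-- Move the lowest digit of the content of register `6` to register `c`. -/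
def takeDigit (c : ℕ) : Command :=
  .seq (.assign 54 quotientExpr) <|
  .seq (.assign c (.sub (.var 6) (timesBaseExpr 54))) (.assign 6 (.var 54))

/-- Add the edge between the vertices in the registers `50` and `51` to the graph in array `2`. -/
def addEdge : Command :=
  .seq (.store 2 (cellExpr 50 51) (.num 1)) (.store 2 (cellExpr 51 50) (.num 1))

/-- The command for `searchStep`. If there is no candidate with the chosen number, then `nth` has the
value `n`, and no edge is added. -/
def stepCommand : Command :=
  .seq (takeDigit 52) <| .seq (takeDigit 53) <|
  .seq (.assign 50 (.nth 31 30 0 (firstEndExpr 30) 52)) <|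
  .when (.lt (.var 50) (.var 0)) <|
  .seq (.assign 51 (.nth 33 32 0 (secondEndExpr 50 32) 53)) <|
  .when (.and (.lt (.var 51) (.var 0)) (adjExpr 1 50 51)) addEdge

/-- Initialise the graph in array `2` as the intersection of the two graphs of the input. -/
def initGraph : Command :=
  .loop 55 0 <| .loop 56 0 <|
  .store 2 (cellExpr 55 56) (.and (adjExpr 0 55 56) (adjExpr 1 55 56))

/-- Set register `8` to one if the choices encoded in register `9` resolve all conflicts. -/
def tryChoices : Command :=
  .seq initGraph <| .seq (.assign 6 (.var 9)) <| .seq (.loop 14 1 stepCommand) <|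
  .when (.not someConflictExpr) (.assign 8 (.num 1))

/-- Try all sequences of choices; register `8` receives the answer. -/
def searchCommand : Command := .seq (.assign 8 (.num 0)) (.loop 9 3 tryChoices)

section

open RAM.Expression

variable {n k d : ℕ} {G Γ E : SimpleGraph (Fin n)} {σ : State}

theorem card_filter_val_lt {m q : ℕ} (h : q ≤ m) :
    Finset.card {i : Fin m | (i : ℕ) < q} = q := by
  rw [Fin.card_filter_val_lt, min_eq_right h]

theorem HoldsInput.eval_timesBaseExpr (h : HoldsInput k d G Γ σ) {r : ℕ} (hr : 41 < r)
    (hF : σ.reg r ≤ paramF k d) : (timesBaseExpr r).eval σ = paramB k d * σ.reg r := by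
  have h0 : r ≠ 40 := by omega
  have h1 : r ≠ 41 := by omega
  have key (i : ℕ) : (count 40 3 (.lt (.var 40) (.var r))).eval (σ.setReg 41 i) = σ.reg r := by
    rw [eval_count (n := paramF k d) (p := fun j => j < σ.reg r) (by simpa using h.reg_three)
      fun j => ?_]
    · exact card_filter_val_lt hF
    · rw [holds_lt]
      simp [eval, h0, h1]
  simp [timesBaseExpr, eval, key, h.reg_five]

theorem paramB_pos (k d : ℕ) : 0 < paramB k d := by simp [paramB]

theorem HoldsInput.eval_quotientExpr (h : HoldsInput k d G Γ σ) (hF : σ.reg 6 < paramF k d) :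
    quotientExpr.eval σ = σ.reg 6 / paramB k d := by
  rw [quotientExpr, eval_count (n := paramF k d) (p := fun j => j < σ.reg 6 / paramB k d)
    h.reg_three fun j => ?_]
  · exact card_filter_val_lt ((Nat.div_le_self _ _).trans hF.le)
  · have h' := h.setReg (x := 43) (a := j) (by omega)
    rw [holds_le, eval, eval, h'.eval_timesBaseExpr (by omega) (by simp [j.2.le]),
      ← Nat.succ_le_iff, Nat.le_div_iff_mul_le (paramB_pos k d)]
    simp [eval, h.reg_five, mul_add, mul_comm]

theorem HoldsInput.run_takeDigit (h : HoldsInput k d G Γ σ) (hF : σ.reg 6 < paramF k d) (c : ℕ) :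
    (takeDigit c).run σ = ((σ.setReg 54 (σ.reg 6 / paramB k d)).setReg c
      (σ.reg 6 % paramB k d)).setReg 6 (((σ.setReg 54 (σ.reg 6 / paramB k d)).setReg c
      (σ.reg 6 % paramB k d)).reg 54) := by
  have h' := h.setReg (x := 54) (a := σ.reg 6 / paramB k d) (by omega)
  have hmod : σ.reg 6 - paramB k d * (σ.reg 6 / paramB k d) = σ.reg 6 % paramB k d := by
    have := Nat.div_add_mod (σ.reg 6) (paramB k d)
    omega
  simp only [takeDigit, Command.run, h.eval_quotientExpr hF, eval]
  rw [h'.eval_timesBaseExpr (by omega)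
    (by simpa using (Nat.div_le_self _ _).trans hF.le)]
  simp [hmod]

theorem Represents.run_addEdge (h : Represents k d G Γ E σ) {a b : Fin n} (hab : a ≠ b)
    (ha : σ.reg 50 = a) (hb : σ.reg 51 = b) :
    Represents k d G Γ (E ⊔ SimpleGraph.fromEdgeSet {s(a, b)}) (addEdge.run σ) := by
  have hrun : addEdge.run σ = (σ.setArr 2 (a * n + b) 1).setArr 2 (b * n + a) 1 := by
    have h1 : (cellExpr 50 51).eval σ = a * n + b := by
      rw [eval_cellExpr h.reg_zero (by omega) ha, hb]
    have h2 : (cellExpr 51 50).eval (σ.setArr 2 (a * n + b) 1) = b * n + a := by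
      rw [eval_cellExpr (σ := σ.setArr 2 (a * n + b) 1) (n := n) (u := b) h.reg_zero (by omega) hb,
        State.setArr_reg, ha]
    simp only [addEdge, Command.run, h1, show ∀ τ, (num 1).eval τ = 1 from fun _ => rfl, h2]
  rw [hrun]
  refine ⟨⟨h.reg_zero, h.reg_one, h.reg_three, h.reg_five, h.reg_seven, fun u v => ?_,
    fun u v => ?_⟩, fun u v => ?_⟩
  · simpa [State.setArr_arr] using h.arr_zero u v
  · simpa [State.setArr_arr] using h.arr_one u v
  · rw [State.setArr_arr, State.setArr_arr, SimpleGraph.sup_adj, SimpleGraph.fromEdgeSet_adj,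
      Set.mem_singleton_iff, Sym2.eq_iff]
    split_ifs with h1 h2
    · obtain ⟨rfl, rfl⟩ := cell_inj h1.2
      simp [hab.symm]
    · obtain ⟨rfl, rfl⟩ := cell_inj h2.2
      simp [hab]
    · rw [h.arr_two]
      refine ⟨Or.inl, fun h3 => h3.resolve_right ?_⟩
      rintro ⟨⟨rfl, rfl⟩ | ⟨rfl, rfl⟩, -⟩
      · exact h2 ⟨rfl, rfl⟩
      · exact h1 ⟨rfl, rfl⟩

theorem Represents.run_stepCommand (h : Represents k d G Γ E σ) (hF : σ.reg 6 < paramF k d) :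
    Represents k d G Γ (searchStep k (paramM k d) (paramB k d) G Γ (E, σ.reg 6)).1
      (stepCommand.run σ) ∧
    (stepCommand.run σ).reg 6 =
      (searchStep k (paramM k d) (paramB k d) G Γ (E, σ.reg 6)).2 := by
  set B := paramB k d
  set c := σ.reg 6 % B with hc
  set c' := σ.reg 6 / B % B with hc'
  have hrun1 := h.run_takeDigit hF 52
  set σ₁ := (takeDigit 52).run σ with hσ₁
  have h₁ : Represents k d G Γ E σ₁ := by
    rw [hrun1]
    exact ((h.setReg (by omega)).setReg (by omega)).setReg (by omega)
  have h₁6 : σ₁.reg 6 = σ.reg 6 / B := by simp [hrun1, B]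
  have hrun2 := h₁.run_takeDigit (by rw [h₁6]; exact (Nat.div_le_self _ _).trans_lt hF) 53
  set σ₂ := (takeDigit 53).run σ₁ with hσ₂
  have h₂ : Represents k d G Γ E σ₂ := by
    rw [hrun2]
    exact ((h₁.setReg (by omega)).setReg (by omega)).setReg (by omega)
  have h₂6 : σ₂.reg 6 = σ.reg 6 / B / B := by simp [hrun2, h₁6, B]
  have h₂c : σ₂.reg 52 = c := by simp [hrun2, hrun1, hc, B]
  have h₂c' : σ₂.reg 53 = c' := by simp [hrun2, h₁6, hc', B]
  set a := (nth 31 30 0 (firstEndExpr 30) 52).eval σ₂ with ha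
  have hfirst (u : Fin n) : a = u ↔ IsNth (IsFirstEnd (paramM k d) Γ E) c u := by
    rw [ha, ← h₂c]
    refine eval_nth h₂.reg_zero (by omega) (by omega) (by omega) (fun i j => ?_) u
    exact ((h₂.setReg (by omega)).setReg (by omega)).holds_firstEndExpr (by omega) (by simp)
  -- without a chosen edge, the command need only leave the graph as it is
  have hnone (hno : chosenEdge k (paramM k d) G Γ E c c' = ∅) {τ : State}
      (hτ : Represents k d G Γ E τ) (hτ6 : τ.reg 6 = σ.reg 6 / B / B) :
      Represents k d G Γ (searchStep k (paramM k d) B G Γ (E, σ.reg 6)).1 τ ∧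
      τ.reg 6 = (searchStep k (paramM k d) B G Γ (E, σ.reg 6)).2 := by
    refine ⟨?_, hτ6⟩
    simp only [searchStep, ← hc, ← hc', hno]
    simpa using hτ
  set σ₃ := σ₂.setReg 50 a with hσ₃
  have h₃ : Represents k d G Γ E σ₃ := h₂.setReg (by omega)
  have h₃6 : σ₃.reg 6 = σ.reg 6 / B / B := by simp [hσ₃, h₂6]
  have h₃a : σ₃.reg 50 = a := by simp [hσ₃]
  have hstep : stepCommand.run σ = Command.run (.when (.lt (.var 50) (.var 0)) <|
    .seq (.assign 51 (.nth 33 32 0 (secondEndExpr 50 32) 53)) <|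
    .when (.and (.lt (.var 51) (.var 0)) (adjExpr 1 50 51)) addEdge) σ₃ := rfl
  rw [hstep, Command.run]
  by_cases han : a < n
  swap
  · rw [if_neg]
    · refine hnone (chosenEdge_eq_empty fun u v _ hu _ => ?_) h₃ h₃6
      have := (hfirst u).2 hu
      omega
    · have : ¬ (lt (.var 50) (.var 0)).Holds σ₃ := by
        rw [holds_lt]
        simpa [eval, h₃a, h₃.reg_zero] using han
      simpa [Holds] using this
  obtain ⟨u, hu⟩ : ∃ u : Fin n, a = u := ⟨⟨a, han⟩, rfl⟩
  have hIu := (hfirst u).1 hu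
  rw [if_pos (show (lt (.var 50) (.var 0)).eval σ₃ ≠ 0 by
    change Holds _ _
    rw [holds_lt]
    simpa [eval, h₃a, h₃.reg_zero] using han)]
  set b := (nth 33 32 0 (secondEndExpr 50 32) 53).eval σ₃ with hb
  have hsecond (v : Fin n) : b = v ↔ IsNth (IsSecondEnd k (paramM k d) G Γ E u) c' v := by
    have h₃c' : σ₃.reg 53 = c' := by simp [hσ₃, h₂c']
    rw [hb, ← h₃c']
    refine eval_nth h₃.reg_zero (by omega) (by omega) (by omega) (fun i j => ?_) v
    exact ((h₃.setReg (by omega)).setReg (by omega)).holds_secondEndExpr (by omega) (by omega)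
      (by simp [h₃a, hu]) (by simp)
  set σ₄ := σ₃.setReg 51 b with hσ₄
  have h₄ : Represents k d G Γ E σ₄ := h₃.setReg (by omega)
  have h₄6 : σ₄.reg 6 = σ.reg 6 / B / B := by simp [hσ₄, h₃6]
  have h₄a : σ₄.reg 50 = u := by simp [hσ₄, h₃a, hu]
  have h₄b : σ₄.reg 51 = b := by simp [hσ₄]
  have hstep' : Command.run (.seq (.assign 51 (.nth 33 32 0 (secondEndExpr 50 32) 53)) <|
    .when (.and (.lt (.var 51) (.var 0)) (adjExpr 1 50 51)) addEdge) σ₃ =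
    if (and (.lt (.var 51) (.var 0)) (adjExpr 1 50 51)).eval σ₄ ≠ 0 then addEdge.run σ₄
    else σ₄ := rfl
  rw [hstep']
  have hguard : (and (.lt (.var 51) (.var 0)) (adjExpr 1 50 51)).eval σ₄ ≠ 0 ↔
      b < n ∧ σ₄.arr 1 (u * n + b) ≠ 0 := by
    change Holds _ _ ↔ _
    rw [holds_and, holds_lt, holds_adjExpr h₄.reg_zero (by omega) h₄a, h₄b]
    simp [eval, h₄b, h₄.reg_zero]
  by_cases hbn : b < n ∧ σ₄.arr 1 (u * n + b) ≠ 0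
  · rw [if_pos (hguard.2 hbn)]
    obtain ⟨v, hv⟩ : ∃ v : Fin n, b = v := ⟨⟨b, hbn.1⟩, rfl⟩
    have hIv := (hsecond v).1 hv
    have huv : Γ.Adj u v := (h₄.arr_one u v).1 (hv ▸ hbn.2)
    refine ⟨?_, h₄6⟩
    simp only [searchStep, ← hc, ← hc', chosenEdge_eq huv hIu hIv, Finset.coe_singleton]
    exact h₄.run_addEdge huv.ne h₄a (h₄b.trans hv)
  · rw [if_neg (mt hguard.1 hbn)]
    refine hnone (chosenEdge_eq_empty fun u' v huv hu' hv => ?_) h₄ h₄6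
    obtain rfl := hu'.unique hIu
    have hbv := (hsecond v).2 hv
    exact hbn ⟨hbv ▸ v.2, by rw [hbv]; exact (h₄.arr_one _ _).2 huv⟩

theorem HoldsInput.run_initGraph (h : HoldsInput k d G Γ σ) :
    Represents k d G Γ (G ⊓ Γ) (initGraph.run σ) := by
  have key := Command.run_loop_induction (x := 55) (r := 0) (σ := σ)
    (c := .loop 56 0 <| .store 2 (cellExpr 55 56) (.and (adjExpr 0 55 56) (adjExpr 1 55 56)))
    -- the rows before the `i`-th one are initialised
    (fun i τ => HoldsInput k d G Γ τ ∧ ∀ u v : Fin n, (u : ℕ) < i →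
      (τ.arr 2 (u * n + v) ≠ 0 ↔ (G ⊓ Γ).Adj u v)) ⟨h, fun u v hu => absurd hu (by omega)⟩ ?_
  · rw [h.reg_zero] at key
    exact ⟨key.1, fun u v => key.2 u v u.2⟩
  rintro i τ hi ⟨hτ, hrows⟩
  rw [h.reg_zero] at hi
  have hτ' := hτ.setReg (x := 55) (a := i) (by omega)
  have key := Command.run_loop_induction (x := 56) (r := 0) (σ := τ.setReg 55 i)
    (c := .store 2 (cellExpr 55 56) (.and (adjExpr 0 55 56) (adjExpr 1 55 56)))
    (fun j ρ => HoldsInput k d G Γ ρ ∧ ρ.reg 55 = i ∧ ∀ u v : Fin n,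
      ((u : ℕ) < i ∨ ((u : ℕ) = i ∧ (v : ℕ) < j)) →
      (ρ.arr 2 (u * n + v) ≠ 0 ↔ (G ⊓ Γ).Adj u v))
    ⟨hτ', by simp, fun u v hu => hrows u v (by omega)⟩ ?_
  · rw [hτ'.reg_zero] at key
    refine ⟨key.1, fun u v hu => key.2.2 u v ?_⟩
    have := v.2
    omega
  rintro j ρ hj ⟨hρ, hρi, hcells⟩
  rw [hτ'.reg_zero] at hj
  have hρ' := hρ.setReg (x := 56) (a := j) (by omega)
  obtain ⟨a, rfl⟩ : ∃ a : Fin n, i = a := ⟨⟨i, hi⟩, rfl⟩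
  obtain ⟨b, rfl⟩ : ∃ b : Fin n, j = b := ⟨⟨j, hj⟩, rfl⟩
  have hρa : (ρ.setReg 56 b).reg 55 = a := by simp [hρi]
  have hρb : (ρ.setReg 56 b).reg 56 = b := by simp
  have hval : (and (adjExpr 0 55 56) (adjExpr 1 55 56)).eval (ρ.setReg 56 b) ≠ 0 ↔
      (G ⊓ Γ).Adj a b := by
    change Holds _ _ ↔ _
    rw [holds_and, hρ'.holds_adjExpr_zero (by omega) hρa hρb,
      hρ'.holds_adjExpr_one (by omega) hρa hρb, SimpleGraph.inf_adj]
  rw [Command.run, eval_cellExpr hρ'.reg_zero (by omega) hρa, hρb]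
  refine ⟨⟨hρ'.reg_zero, hρ'.reg_one, hρ'.reg_three, hρ'.reg_five, hρ'.reg_seven, fun u v => ?_,
    fun u v => ?_⟩, hρa, fun u v huv => ?_⟩
  · simpa [State.setArr_arr] using hρ.arr_zero u v
  · simpa [State.setArr_arr] using hρ.arr_one u v
  · rw [State.setArr_arr]
    split_ifs with h1
    · obtain ⟨rfl, rfl⟩ := cell_inj h1.2
      exact hval
    · refine hcells u v ?_
      rcases huv with huv | ⟨h2, h3⟩
      · exact Or.inl huv
      · refine Or.inr ⟨h2, lt_of_le_of_ne (by omega) fun h4 => h1 ⟨rfl, ?_⟩⟩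
        rw [h2, h4]

theorem stepCommand_ok : stepCommand.ok 60 [0, 1, 3, 5, 8, 9] = true := by decide +kernel

theorem initGraph_ok : initGraph.ok 60 [0, 1, 3, 5, 8, 9] = true := by decide +kernel

theorem searchCommand_ok : searchCommand.ok 60 [0, 1, 3, 5] = true := by decide +kernel

open scoped Classical in
theorem HoldsInput.run_tryChoices (h : HoldsInput k d G Γ σ) (hF : σ.reg 9 < paramF k d) :
    HoldsInput k d G Γ (tryChoices.run σ) ∧
    (tryChoices.run σ).reg 8 = if ∀ u v, ¬ Conflict Γ
      ((searchStep k (paramM k d) (paramB k d) G Γ)^[k] (G ⊓ Γ, σ.reg 9)).1 u v then 1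
      else σ.reg 8 := by
  set σ₁ := initGraph.run σ with hσ₁
  have h₁ : Represents k d G Γ (G ⊓ Γ) σ₁ := h.run_initGraph
  have h₁8 : σ₁.reg 8 = σ.reg 8 := Command.run_reg_of_mem _ initGraph_ok (by decide) σ
  have h₁9 : σ₁.reg 9 = σ.reg 9 := Command.run_reg_of_mem _ initGraph_ok (by decide) σ
  set σ₂ := σ₁.setReg 6 (σ₁.reg 9) with hσ₂
  have h₂ : Represents k d G Γ (G ⊓ Γ) σ₂ := h₁.setReg (by omega)
  set σ₃ := (Command.loop 14 1 stepCommand).run σ₂ with hσ₃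
  have h₃ := Command.run_loop_induction (x := 14) (r := 1) (σ := σ₂) (c := stepCommand)
    (fun i τ => Represents k d G Γ
      ((searchStep k (paramM k d) (paramB k d) G Γ)^[i] (G ⊓ Γ, σ.reg 9)).1 τ ∧
      τ.reg 6 = ((searchStep k (paramM k d) (paramB k d) G Γ)^[i] (G ⊓ Γ, σ.reg 9)).2 ∧
      τ.reg 6 < paramF k d ∧ τ.reg 8 = σ.reg 8)
    ⟨h₂, by simp [hσ₂, h₁9], by simpa [hσ₂, h₁9] using hF, by simp [hσ₂, h₁8]⟩ (by
      rintro i τ - ⟨hτ, hτ6, hτF, hτ8⟩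
      have hr6 : (τ.setReg 14 i).reg 6 = τ.reg 6 := by simp
      have hstep := (hτ.setReg (x := 14) (a := i) (by omega)).run_stepCommand (by rwa [hr6])
      rw [hr6, hτ6] at hstep
      rw [Function.iterate_succ_apply']
      refine ⟨hstep.1, hstep.2, ?_, ?_⟩
      · rw [hstep.2]
        refine lt_of_le_of_lt ?_ hτF
        rw [hτ6]
        exact (Nat.div_le_self _ _).trans (Nat.div_le_self _ _)
      · rw [Command.run_reg_of_mem _ stepCommand_ok (by decide)]
        simpa using hτ8)
  rw [h₂.reg_one, ← hσ₃] at h₃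
  obtain ⟨h₃, -, -, h₃8⟩ := h₃
  have hrun : tryChoices.run σ = if (not someConflictExpr).eval σ₃ ≠ 0 then σ₃.setReg 8 1 else σ₃ :=
    rfl
  have hcond : (not someConflictExpr).eval σ₃ ≠ 0 ↔ ∀ u v, ¬ Conflict Γ
      ((searchStep k (paramM k d) (paramB k d) G Γ)^[k] (G ⊓ Γ, σ.reg 9)).1 u v := by
    change Holds _ _ ↔ _
    rw [holds_not, h₃.holds_someConflictExpr]
    push Not
    rfl
  rw [hrun]
  simp only [hcond]
  split_ifs
  · exact ⟨h₃.toHoldsInput.setReg (by omega), by simp⟩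
  · exact ⟨h₃.toHoldsInput, h₃8⟩

open scoped Classical in
theorem HoldsInput.run_searchCommand (h : HoldsInput k d G Γ σ) (hG : BicliqueFree d G) :
    (searchCommand.run σ).reg 8 = if IsYesInstance 2 G Γ k then 1 else 0 := by
  have h' := h.setReg (x := 8) (a := 0) (by omega)
  have hite (p q : Prop) [Decidable p] [Decidable q] [Decidable (q ∨ p)] :
      (if p then 1 else if q then 1 else 0) = if q ∨ p then 1 else 0 := by
    by_cases hp : p <;> by_cases hq : q <;> simp [hp, hq]
  have key := Command.run_loop_induction (x := 9) (r := 3) (σ := σ.setReg 8 0) (c := tryChoices)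
    (fun i τ => HoldsInput k d G Γ τ ∧ τ.reg 8 = if ∃ g < i, ∀ u v, ¬ Conflict Γ
      ((searchStep k (paramM k d) (paramB k d) G Γ)^[k] (G ⊓ Γ, g)).1 u v then 1 else 0)
    ⟨h', by simp⟩ (by
      rintro i τ hi ⟨hτ, hτ8⟩
      rw [h'.reg_three] at hi
      have h9 : (τ.setReg 9 i).reg 9 = i := by simp
      have hrun := (hτ.setReg (x := 9) (a := i) (by omega)).run_tryChoices (by rwa [h9])
      rw [h9] at hrun
      refine ⟨hrun.1, hrun.2.trans ?_⟩
      simp only [State.setReg_reg, show (8 : ℕ) ≠ 9 by omega, if_false, hτ8,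
        Nat.lt_succ_iff_lt_or_eq, or_and_right, exists_or, exists_eq_left]
      exact hite _ _)
  rw [h'.reg_three] at key
  refine key.2.trans ?_
  simp only [isYesInstance_two_iff_exists_search hG]

end

/-! ### The program -/

/-- The command `x := 2 ^ y` for registers `x` and `y`. It uses register `14` as its counter. -/
def powCommand (x y : ℕ) : Command :=
  .seq (.assign x (.num 1)) (.loop 14 y (.assign x (.add (.var x) (.var x))))

theorem run_powCommand {x y : ℕ} (hxy : x ≠ y) (hx : x ≠ 14) (σ : State) :
    ((powCommand x y).run σ).arr = σ.arr ∧ ∀ z, z ≠ 14 →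
      ((powCommand x y).run σ).reg z = if z = x then 2 ^ σ.reg y else σ.reg z := by
  have key := Command.run_loop_induction (x := 14) (r := y) (σ := σ.setReg x 1)
    (c := .assign x (.add (.var x) (.var x)))
    (fun i τ => τ.arr = σ.arr ∧ ∀ z, z ≠ 14 → τ.reg z = if z = x then 2 ^ i else σ.reg z)
    ⟨rfl, by simp⟩ (by
      rintro i τ - ⟨h1, h2⟩
      refine ⟨h1, fun z hz => ?_⟩
      by_cases hzx : z = x
      · simp [Command.run, Expression.eval, hzx, hx, h2 x hx, pow_succ, mul_two]
      · simp [Command.run, hzx, hz, h2 z hz])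
  rw [State.setReg_reg, if_neg hxy.symm] at key
  exact key

end Dilation

namespace RAM

/-- Symbolic execution of a command, followed by a program `Q`. -/
theorem Command.achieves_seq {W X b : ℕ} {R : List ℕ} {c : Command} {Q : Program} {σ s : State}
    {φ : State → Prop} (hc : c.ok W R = true) (hσ : Agree W σ s) (hX : ∀ r ∈ R, σ.reg r ≤ X)
    (h : ∀ s', Agree W (c.run σ) s' → Q.Achieves s' b φ) :
    (Program.seq (c.code W) Q).Achieves s (c.time X + b) φ :=
  ((c.code_spec hc le_rfl hσ fun r _ hr => hX r hr).mono le_rfl fun s' hs => h s' hs.1).seq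

end RAM

namespace Dilation

open RAM

/-- The whole algorithm: compute the parameters, search for a solution, and output the answer. -/
def mainCommand : Command :=
  .seq (.assign 4 (.add (.add (.var 1) (.var 2)) (.num 2))) <| .seq (powCommand 10 4) <|
  .seq (.assign 4 (.add (.var 10) (.var 10))) <| .seq (powCommand 7 4) <|
  .seq (.assign 4 (.add (.var 4) (.var 4))) <| .seq (powCommand 11 4) <|
  .seq (.assign 4 (.add (.add (.var 11) (.var 11)) (.add (.var 11) (.var 11)))) <|
  .seq (powCommand 5 4) <| .seq (powCommand 3 5) <|
  .seq searchCommand (.assign 0 (.var 8))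

theorem adjArray_ne_zero_iff {n : ℕ} (G : SimpleGraph (Fin n)) (u v : Fin n) :
    adjArray G (u * n + v) ≠ 0 ↔ G.Adj u v := by
  rw [adjArray]
  split_ifs with h
  · obtain ⟨u', v', h1, h2⟩ := h
    obtain ⟨rfl, rfl⟩ := cell_inj h2
    simpa using h1
  · simpa using fun h1 => h ⟨u, v, h1, rfl⟩

theorem param_chain (k d : ℕ) : k + d + 2 ≤ paramN k d ∧ 4 * paramN k d ≤ paramQ k d ∧
    4 * paramQ k d ≤ paramB k d ∧ paramB k d ≤ paramF k d :=
  ⟨Nat.lt_two_pow_self.le, Nat.lt_two_pow_self.le, Nat.lt_two_pow_self.le, Nat.lt_two_pow_self.le⟩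

theorem mainCommand_achieves {n : ℕ} (G Γ : SimpleGraph (Fin n)) (k d : ℕ)
    (hG : BicliqueFree d G) :
    (mainCommand.code 60).Achieves (inputState G Γ k d)
      (mainCommand.time (paramF k d * (n + 1)))
      fun s => Answers s (IsYesInstance 2 G Γ k) := by
  obtain ⟨hN, hQ, hB, hF⟩ := param_chain k d
  set X := paramF k d * (n + 1) with hX
  have hFX : paramF k d ≤ X := Nat.le_mul_of_pos_right _ (by omega)
  have hnX : n ≤ X := by
    have : 1 * (n + 1) ≤ X := Nat.mul_le_mul_right _ (by omega)
    omega
  set σ₀ := inputState G Γ k d with hσ₀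
  have r0 : σ₀.reg 0 = n := rfl
  have r1 : σ₀.reg 1 = k := rfl
  have r2 : σ₀.reg 2 = d := rfl
  refine Command.achieves_seq (R := []) (by decide) (σ := σ₀) ⟨rfl, fun _ _ => rfl⟩ (by simp)
    fun s₁ hs₁ => ?_
  set σ₁ := Command.run (.assign 4 (.add (.add (.var 1) (.var 2)) (.num 2))) σ₀ with hσ₁
  have q1 : ∀ z, σ₁.reg z = if z = 4 then k + d + 2 else σ₀.reg z := fun z => by
    simp [hσ₁, Command.run, Expression.eval, r1, r2]
  refine Command.achieves_seq (R := [4]) (by decide) hs₁ ?_ fun s₂ hs₂ => ?_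
  · simp only [List.mem_singleton, forall_eq, q1, if_true]
    omega
  obtain ⟨a2, q2⟩ := run_powCommand (x := 10) (y := 4) (by omega) (by omega) σ₁
  set σ₂ := (powCommand 10 4).run σ₁
  have e2 : σ₂.reg 10 = paramN k d := by simp [q2, q1, paramN]
  refine Command.achieves_seq (R := []) (by decide) hs₂ (by simp) fun s₃ hs₃ => ?_
  set σ₃ := Command.run (.assign 4 (.add (.var 10) (.var 10))) σ₂ with hσ₃
  have q3 : ∀ z, σ₃.reg z = if z = 4 then 2 * paramN k d else σ₂.reg z := fun z => by
    simp [hσ₃, Command.run, Expression.eval, e2, two_mul]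
  refine Command.achieves_seq (R := [4]) (by decide) hs₃ ?_ fun s₄ hs₄ => ?_
  · simp only [List.mem_singleton, forall_eq, q3, if_true]
    omega
  obtain ⟨a4, q4⟩ := run_powCommand (x := 7) (y := 4) (by omega) (by omega) σ₃
  set σ₄ := (powCommand 7 4).run σ₃
  refine Command.achieves_seq (R := []) (by decide) hs₄ (by simp) fun s₅ hs₅ => ?_
  set σ₅ := Command.run (.assign 4 (.add (.var 4) (.var 4))) σ₄ with hσ₅
  have q5 : ∀ z, σ₅.reg z = if z = 4 then 4 * paramN k d else σ₄.reg z := fun z => by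
    have : 2 * paramN k d + 2 * paramN k d = 4 * paramN k d := by omega
    simp [hσ₅, Command.run, Expression.eval, q4, q3, this]
  refine Command.achieves_seq (R := [4]) (by decide) hs₅ ?_ fun s₆ hs₆ => ?_
  · simp only [List.mem_singleton, forall_eq, q5, if_true]
    omega
  obtain ⟨a6, q6⟩ := run_powCommand (x := 11) (y := 4) (by omega) (by omega) σ₅
  set σ₆ := (powCommand 11 4).run σ₅
  have e6 : σ₆.reg 11 = paramQ k d := by simp [q6, q5, paramQ]
  refine Command.achieves_seq (R := []) (by decide) hs₆ (by simp) fun s₇ hs₇ => ?_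
  set σ₇ := Command.run
    (.assign 4 (.add (.add (.var 11) (.var 11)) (.add (.var 11) (.var 11)))) σ₆ with hσ₇
  have q7 : ∀ z, σ₇.reg z = if z = 4 then 4 * paramQ k d else σ₆.reg z := fun z => by
    have : paramQ k d + paramQ k d + (paramQ k d + paramQ k d) = 4 * paramQ k d := by omega
    simp [hσ₇, Command.run, Expression.eval, e6, this]
  refine Command.achieves_seq (R := [4]) (by decide) hs₇ ?_ fun s₈ hs₈ => ?_
  · simp only [List.mem_singleton, forall_eq, q7, if_true]
    omega
  obtain ⟨a8, q8⟩ := run_powCommand (x := 5) (y := 4) (by omega) (by omega) σ₇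
  set σ₈ := (powCommand 5 4).run σ₇
  have e8 : σ₈.reg 5 = paramB k d := by simp [q8, q7, paramB]
  refine Command.achieves_seq (R := [5]) (by decide) hs₈ ?_ fun s₉ hs₉ => ?_
  · simp only [List.mem_singleton, forall_eq, e8]
    omega
  obtain ⟨a9, q9⟩ := run_powCommand (x := 3) (y := 5) (by omega) (by omega) σ₈
  set σ₉ := (powCommand 3 5).run σ₈
  have harr : σ₉.arr = σ₀.arr := by rw [a9, a8]; exact (a6.trans a4).trans a2
  have hinput : HoldsInput k d G Γ σ₉ := by
    refine ⟨?_, ?_, ?_, ?_, ?_, fun u v => ?_, fun u v => ?_⟩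
    · simp [q9, q8, q7, q6, q5, q4, q3, q2, q1, r0]
    · simp [q9, q8, q7, q6, q5, q4, q3, q2, q1, r1]
    · simp [q9, e8, paramF]
    · simp [q9, e8]
    · simp [q9, q8, q7, q6, q5, q4, q3, paramM]
    · rw [harr]
      exact adjArray_ne_zero_iff G u v
    · rw [harr]
      exact adjArray_ne_zero_iff Γ u v
  refine Command.achieves_seq (R := [0, 1, 3, 5]) searchCommand_ok hs₉ ?_ fun s₁₀ hs₁₀ => ?_
  · simp only [List.mem_cons, List.not_mem_nil, or_false]
    rintro r (rfl | rfl | rfl | rfl)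
    · rwa [hinput.reg_zero]
    · rw [hinput.reg_one]
      omega
    · rwa [hinput.reg_three]
    · rw [hinput.reg_five]
      omega
  refine (Command.code_spec (R := []) _ (by decide) le_rfl hs₁₀ (by simp)).mono le_rfl
    fun s hs => ?_
  rw [Answers, ← hs.1.2 0 (by omega), ← hinput.run_searchCommand hG]
  simp [Command.run, Expression.eval]

theorem primrec_paramF : Primrec₂ paramF := by
  have hpow : Primrec₂ ((· ^ ·) : ℕ → ℕ → ℕ) := Primrec₂.unpaired'.1 Nat.Primrec.pow
  have hexp {f : ℕ × ℕ → ℕ} (hf : Primrec f) : Primrec fun p => 2 ^ f p :=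
    hpow.comp (Primrec.const 2) hf
  have hfour {f : ℕ × ℕ → ℕ} (hf : Primrec f) : Primrec fun p => 4 * f p :=
    Primrec.nat_mul.comp (Primrec.const 4) hf
  have hN : Primrec fun p : ℕ × ℕ => paramN p.1 p.2 :=
    hexp (Primrec.nat_add.comp (Primrec.nat_add.comp Primrec.fst Primrec.snd) (Primrec.const 2))
  exact hexp (hexp (hfour (hexp (hfour hN))))

theorem computable_mul_paramF_pow (K D : ℕ) : Computable₂ fun k d => K * paramF k d ^ D := by
  have hpow : Primrec₂ ((· ^ ·) : ℕ → ℕ → ℕ) := Primrec₂.unpaired'.1 Nat.Primrec.pow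
  exact (Primrec.nat_mul.comp (Primrec.const K)
    (hpow.comp primrec_paramF (Primrec.const D))).to_comp

end Dilation

theorem mainTheorem1 :
    ∃ (P : RAM.Program) (f : ℕ → ℕ → ℕ) (c : ℕ), Computable₂ f ∧
      ∀ (n : ℕ) (G Γ : SimpleGraph (Fin n)) (k d : ℕ), Dilation.BicliqueFree d G →
        ∃ (s : RAM.State) (T : ℕ),
          RAM.Exec P (Dilation.inputState G Γ k d) s T ∧
          T ≤ f k d * (n + 1) ^ c ∧
          Dilation.Answers s (Dilation.IsYesInstance 2 G Γ k) := by
  obtain ⟨K, D, hKD⟩ := Dilation.mainCommand.exists_time_le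
  refine ⟨Dilation.mainCommand.code 60, fun k d => K * Dilation.paramF k d ^ D, D,
    Dilation.computable_mul_paramF_pow K D, fun n G Γ k d hG => ?_⟩
  obtain ⟨s, T, hs, hT, hans⟩ := Dilation.mainCommand_achieves G Γ k d hG
  refine ⟨s, T, hs, hT.trans ((hKD _ ?_).trans_eq ?_), hans⟩
  · exact Nat.one_le_iff_ne_zero.2 (by simp [Dilation.paramF])
  · rw [mul_pow, mul_assoc]
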